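/- **Setting.** Let $\mathbb F_q$ be a finite field with $q$ elements, $X$ a smooth projective geometrically connected curve over $\mathbb F_q$ with a rational point $\infty\in X(\mathbb F_q)$, $K$ its function field, $A\subset K$ the ring of functions regular away from $\infty$, $\mathbb C_\infty$ the completion of an algebraic closure of the completion $K_\infty$ of $K$ at $\infty$, and $L$ an algebraically closed field with $K\subset L\subset\mathbb C_\infty$. For $i\in\mathbb Z$ write $(\cdot)^{(i)}$ for the twist $\ell\mapsto\ell^{q^i}$ on $L$, $\ell\otimes a\mapsto \ell^{q^i}\otimes a$ on $L\otimes_{\mathbb F_q}A$ and on its fraction field $\mathbb K$ (the function field of $L\times X$), and for its coordinatewise extension to vectors and matrices. Let $J\subset L\otimes A$ be the ideal generated by all $1\otimes a-a\otimes1$, and let $\Xi^{(i)}$ be the point of $\operatorname{Spec}(L\otimes A)$ with ideal $J^{(i)}$, $\Xi=\Xi^{(0)}$. In $L[\tau]$ and $(L\otimes A)[\tau]$ we have $\tau s=s^{(1)}\tau$; in $L[\sigma]$ and $(L\otimes A)[\sigma]$ we have $\sigma s=s^{(-1)}\sigma$. For $\alpha=\sum a_i\tau^i\in L[\tau]$ put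 $\alpha^*=\sum a_i^{(-i)}\sigma^i\in L[\sigma]$, and for a matrix $B$ over $L[\tau]$ let $B^*$ be the transpose with $*$ applied to the entries. Let $\phi:A\to \mathrm{Mat}_d(L[\tau])$ be a $d$-dimensional Anderson $A$-module over $L$, that is, an $\mathbb F_q$-algebra homomorphism such that for every $a$ the constant term $d[a]$ of $\phi_a$ differs from $a\cdot I$ by a nilpotent matrix. Its $A$-motive is $M=L[\tau]^{1\times d}$, where $\ell\in L$ and $\tau$ act by left multiplication and $a\in A$ acts by $m\mapsto m\phi_a$; its dual $A$-motive is $N=L[\tau]^{d\times 1}$, with $\ell\cdot n=n\ell$, $\sigma n=n\tau$ and $a\cdot n=\phi_a n$. Assume that $\phi$ is abelian: $M$ is a finitely generated projective $L\otimes A$-module of constant rank $r$. Put $M_K=M\otimes_{L\otimes A}\mathbb K$ and $N_K=N\otimes_{L\otimes A}\mathbb K$, with the induced actions of $\tau$ and $\sigma$. *Bases.* (1) Fix $\mathbb K$-bases $c_1,\dots,c_r$ of $M_K$ and $d_1,\dots,d_r$ of $N_K$ and a matrix $\Phi\in\mathrm{Mat}_r(\mathbb K)$ with $\tau(c_1,\dots,c_r)^\top=\Phi(c_1,\dots,c_r)^\top$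 and $\sigma(d_1,\dots,d_r)^\top=\Phi^\top(d_1,\dots,d_r)^\top$. Assume that $\phi$ is $\Xi$-regular with respect to them: $\det\Phi$ and all entries of $\Phi$ are regular at $\Xi^{(i)}$ for all $i\in\mathbb Z$. (2) Fix an $L[\tau]$-basis $g_1,\dots,g_d$ of $M$ and an $L[\sigma]$-basis $h_1,\dots,h_d$ of $N$ such that, for all $a\in A$, $a(g_1,\dots,g_d)^\top=\phi_a(g_1,\dots,g_d)^\top$ and $a(h_1,\dots,h_d)^\top=\phi_a^*(h_1,\dots,h_d)^\top$ (for instance the standard bases). *The maps $\delta$.* If $m=\sum_{k,i}c_{k,i}\tau^i g_k\in M$ with $c_{k,i}\in L$, put $\delta_0^M(m)=(c_{1,0},\dots,c_{d,0})^\top\in L^d$. This map factors through $M/J^dM$, which is also the quotient modulo $J^d$ of the localization of $M$ at $\Xi$; in this way $\delta_0^M$ is extended to all elements of $M_K$ that are regular at $\Xi$ (lie in this localization). On $M_K$, in the coordinates with respect to $c_1,\dots,c_r$, $\tau^{-1}$ maps the column vector $a$ to $((\Phi^{-1})^\top)^{(-1)}a^{(-1)}$. Elements of $N\otimes_{L[\sigma]}L[[\sigma]]$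 are written $\sum_{k,j}c_{k,j}\sigma^j h_k$ with $c_{k,j}\in L$; $N[[\sigma]]$ consists of those with $(c_{1,j},\dots,c_{d,j})^{(j)}\to0$ in $\mathbb C_\infty^d$ as $j\to\infty$, and on them $\delta_1^N\bigl(\sum c_{k,j}\sigma^jh_k\bigr)=\sum_{j\ge0}\bigl((c_{1,j},\dots,c_{d,j})^\top\bigr)^{(j)}\in\mathbb C_\infty^d$. **Theorem.** (a) For all $x\in(L\otimes A)[\tau]$, $y\in(L\otimes A)[\sigma]$ and $\mathbf z\in L^d$, the elements $\tau^{-i}(x(g_k))$ are regular at $\Xi$, and $$\sum_{i=0}^\infty\sum_{k=1}^d\delta_0^M\bigl(\tau^{-i}(x(g_k))\bigr)^\top\mathbf z\;\sigma^i(y(h_k))$$ is a well-defined element of $N\otimes_{L[\sigma]}L[[\sigma]]$ (only finitely many $i$ contribute to each coefficient) and belongs to $N[[\sigma]]$. Let $F(x,y;\mathbf z)\in\mathbb C_\infty^d$ be its image under $\delta_1^N$. (b) There is exactly one series $\mathrm{Exp}_\phi(\mathbf z)=\sum_{i\ge0}Q_i\mathbf z^{(i)}$ with $Q_i\in\mathrm{Mat}_d(\mathbb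 C_\infty)$ and $Q_0=I$ that satisfies $\mathrm{Exp}_\phi(d[a]\mathbf z)=\phi_a(\mathrm{Exp}_\phi(\mathbf z))$ for all $a\in A$ as formal power series; it converges for all $\mathbf z\in\mathbb C_\infty^d$, and for all $\mathbf z\in L^d$ $$F(1,1;\mathbf z)=\mathrm{Exp}_\phi(\mathbf z).$$ -/

import Mathlib

open scoped TensorProduct Topology

noncomputable section

/-! ### Skew polynomial rings -/

/-- The ring `R`, remembering the endomorphism `θ` by which the skew variable acts on it. -/
@[nolint unusedArguments]
def Twisted (k R : Type*) [CommRing k] [CommRing R] [Algebra k R] (_θ : R →ₐ[k] R) : Type _ := R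

namespace Twisted

variable {k R : Type*} [CommRing k] [CommRing R] [Algebra k R] (θ : R →ₐ[k] R)

instance : CommRing (Twisted k R θ) := inferInstanceAs (CommRing R)

/-- The `n`-th power of the skew variable acts on the coefficients by `θ ^ n`. -/
instance : MulSemiringAction (Multiplicative ℕ) (Twisted k R θ) :=
  MulSemiringAction.compHom R (powersHom (R →+* R) (θ : R →+* R))

end Twisted

/-- The skew polynomial ring `R[X; θ]`: polynomials `∑ aᵢ Xⁱ` with the rule `X a = θ(a) X`. -/
def SkewPoly (k R : Type*) [CommRing k] [CommRing R] [Algebra k R] (θ : R →ₐ[k] R) : Type _ :=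
  SkewPolynomial (Twisted k R θ)

namespace SkewPoly

variable {k R : Type*} [CommRing k] [CommRing R] [Algebra k R] {θ : R →ₐ[k] R}

instance : Ring (SkewPoly k R θ) := inferInstanceAs (Ring (SkewPolynomial (Twisted k R θ)))

/-- The coefficient `aᵢ` of `∑ aᵢ Xⁱ`. -/
def coeff (p : SkewPoly k R θ) (i : ℕ) : R := SkewPolynomial.coeff (R := Twisted k R θ) p i

/-- The monomial `a Xⁱ`. -/
def monomial (i : ℕ) (a : R) : SkewPoly k R θ :=
  SkewPolynomial.monomial (R := Twisted k R θ) i a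

/-- The sum `∑ f i aᵢ` over the (finitely many) nonzero coefficients of `∑ aᵢ Xⁱ`. -/
def sum {P : Type*} [AddCommMonoid P] (p : SkewPoly k R θ) (f : ℕ → R → P) : P :=
  SkewPolynomial.sum (R := Twisted k R θ) p f

/-- The constants. -/
def C : R →+* SkewPoly k R θ := SkewMonoidAlgebra.singleOneRingHom (k := Twisted k R θ)

/-- The skew variable. -/
def X : SkewPoly k R θ := monomial 1 1

theorem monomial_mul_monomial (i j : ℕ) (a b : R) :
    (monomial i a * monomial j b : SkewPoly k R θ) = monomial (i + j) (a * (θ ^ i) b) := by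
  have h := SkewMonoidAlgebra.single_mul_single (k := Twisted k R θ)
    (a₁ := Multiplicative.ofAdd i) (a₂ := Multiplicative.ofAdd j) (b₁ := a) (b₂ := b)
  have e : @HSMul.hSMul (Multiplicative ℕ) (Twisted k R θ) (Twisted k R θ) _
      (Multiplicative.ofAdd i) b = (θ ^ i) b := by
    change ((θ : R →+* R) ^ i) b = (θ ^ i) b
    simp [RingHom.coe_pow]
  rw [e] at h
  exact h

theorem C_eq (a : R) : (C a : SkewPoly k R θ) = monomial 0 a := rfl

theorem X_mul_C (a : R) : (X * C a : SkewPoly k R θ) = C (θ a) * X := by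
  simp [X, C_eq, monomial_mul_monomial]

theorem induction_on {P : SkewPoly k R θ → Prop} (p : SkewPoly k R θ)
    (hm : ∀ i a, P (monomial i a)) (ha : ∀ p q, P p → P q → P (p + q)) : P p :=
  SkewMonoidAlgebra.induction_on' (k := Twisted k R θ) (p := P) p
    (fun i a => hm (Multiplicative.toAdd i) a) (fun p q => ha p q)

instance : Algebra k (SkewPoly k R θ) :=
  RingHom.toAlgebra' (C.comp (algebraMap k R)) (by
    intro c p
    induction p using induction_on with
    | hm i a =>
      simp [C_eq, monomial_mul_monomial, mul_comm]
    | ha p q hp hq => rw [mul_add, add_mul, hp, hq])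

/-- `∑ aᵢ Xⁱ` acts on a module on which `X` acts as `T`, by `m ↦ ∑ aᵢ • Tⁱ m`. -/
def act {M : Type*} [AddCommMonoid M] [Module R M] (p : SkewPoly k R θ) (T : M → M) (m : M) : M :=
  p.sum fun i a => a • T^[i] m

end SkewPoly

section Motives

variable (Fq A L : Type*) [Field Fq] [Fintype Fq] [CommRing A] [Algebra Fq A]
  [Field L] [Algebra Fq L] [IsAlgClosed L]

/-! ### Frobenius twists -/

/-- The `q`-power Frobenius `ℓ ↦ ℓ^q` of the algebraically closed field `L`, where `q = #Fq`. -/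
def frob : L ≃ₐ[Fq] L :=
  AlgEquiv.ofBijective (FiniteField.frobeniusAlgHom Fq L)
    ⟨(FiniteField.frobeniusAlgHom Fq L).toRingHom.injective, fun x => by
      obtain ⟨z, hz⟩ := IsAlgClosed.exists_pow_nat_eq x (Fintype.card_pos (α := Fq))
      exact ⟨z, by simpa using hz⟩⟩

theorem frob_apply (x : L) : frob Fq L x = x ^ Fintype.card Fq := by
  rfl

/-- The ring `L ⊗ A`. -/
abbrev LA : Type _ := L ⊗[Fq] A

/-- The Frobenius twist `ℓ ⊗ a ↦ ℓ^q ⊗ a` of `L ⊗ A`. -/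
def twist : LA Fq A L ≃ₐ[Fq] LA Fq A L :=
  Algebra.TensorProduct.congr (frob Fq L) AlgEquiv.refl

/-- The function field of the curve over `L`: the fractions of `L ⊗ A`. -/
abbrev LK : Type _ := FractionRing (LA Fq A L)

/-- The Frobenius twist on the function field. -/
def twistK : LK Fq A L ≃+* LK Fq A L :=
  IsFractionRing.ringEquivOfRingEquiv (twist Fq A L).toRingEquiv

theorem twistK_algebraMap (s : LA Fq A L) :
    twistK Fq A L (algebraMap _ _ s) = algebraMap _ _ (twist Fq A L s) :=
  IsFractionRing.ringEquivOfRingEquiv_algebraMap (twist Fq A L).toRingEquiv s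

theorem twistK_symm_algebraMap (s : LA Fq A L) :
    (twistK Fq A L).symm (algebraMap _ _ s) = algebraMap _ _ ((twist Fq A L).symm s) := by
  rw [RingEquiv.symm_apply_eq, twistK_algebraMap, AlgEquiv.apply_symm_apply]

/-- The ring `L[τ]`, with `τ ℓ = ℓ^q τ`. -/
abbrev LTau : Type _ := SkewPoly Fq L (frob Fq L : L →ₐ[Fq] L)

/-- The ring `L[σ]`, with `σ ℓ = ℓ^(1/q) σ`. -/
abbrev LSigma : Type _ := SkewPoly Fq L ((frob Fq L).symm : L →ₐ[Fq] L)

/-- The ring `(L ⊗ A)[τ]`. -/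
abbrev LATau : Type _ := SkewPoly Fq (LA Fq A L) (twist Fq A L : LA Fq A L →ₐ[Fq] LA Fq A L)

/-- The ring `(L ⊗ A)[σ]`. -/
abbrev LASigma : Type _ :=
  SkewPoly Fq (LA Fq A L) ((twist Fq A L).symm : LA Fq A L →ₐ[Fq] LA Fq A L)

variable {Fq L} in
/-- The map `* : L[τ] → L[σ]`, `∑ aᵢ τⁱ ↦ ∑ aᵢ^{(-i)} σⁱ`. -/
def starMap (p : LTau Fq L) : LSigma Fq L :=
  p.sum fun i a => SkewPoly.monomial i (((frob Fq L).symm ^ i) a)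

/-! ### The point `Ξ` and its twists -/

variable [Algebra A L]

/-- The ideal `J` of `L ⊗ A` generated by all `1 ⊗ a - a ⊗ 1`; it is the ideal of the point `Ξ`. -/
def idealJ : Ideal (LA Fq A L) :=
  Ideal.span (Set.range fun a : A => (1 : L) ⊗ₜ[Fq] a - algebraMap A L a ⊗ₜ[Fq] (1 : A))

/-- The ideal of the twisted point `Ξ^{(i)}`, for `i ∈ ℤ`. -/
def idealXi (i : ℤ) : Ideal (LA Fq A L) :=
  (idealJ Fq A L).map ((twist Fq A L) ^ i : LA Fq A L ≃ₐ[Fq] LA Fq A L)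

variable {Fq A L} in
/-- `f` is regular at `Ξ^{(i)}`: it is a fraction whose denominator does not vanish there. -/
def RegularAt (f : LK Fq A L) (i : ℤ) : Prop :=
  ∃ s t : LA Fq A L, s ∉ idealXi Fq A L i ∧
    algebraMap (LA Fq A L) (LK Fq A L) s * f = algebraMap (LA Fq A L) (LK Fq A L) t

/-! ### Anderson modules and their motives -/

/-- A `d`-dimensional Anderson `A`-module over `L`: an `Fq`-algebra homomorphism from `A` to the
`d × d` matrices over `L[τ]` such that the constant term of `φ a` is `a • 1` plus a nilpotent. -/
structure AndersonModule (d : ℕ) where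
  /-- The map `a ↦ φ a`. -/
  toAlgHom : A →ₐ[Fq] Matrix (Fin d) (Fin d) (LTau Fq L)
  isNilpotent : ∀ a : A,
    IsNilpotent ((toAlgHom a).map (fun p => p.coeff 0) - Matrix.scalar (Fin d) (algebraMap A L a))

namespace AndersonModule

variable {Fq A L} {d : ℕ} (φ : AndersonModule Fq A L d)

/-- The coefficient `Aᵢ` in `φ a = ∑ Aᵢ τⁱ`. -/
def coeff (a : A) (i : ℕ) : Matrix (Fin d) (Fin d) L := (φ.toAlgHom a).map fun p => p.coeff i

/-- `d[a]`, the constant term of `φ a`. -/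
def lie (a : A) : Matrix (Fin d) (Fin d) L := φ.coeff a 0

/-- The `A`-motive `M = Hom(φ, 𝔾ₐ)` of `φ`: row vectors of length `d` over `L[τ]`. -/
@[nolint unusedArguments]
def Motive (_φ : AndersonModule Fq A L d) : Type _ := Fin d → LTau Fq L

/-- The dual `A`-motive `N = Hom(𝔾ₐ, φ)` of `φ`: column vectors of length `d` over `L[τ]`. -/
@[nolint unusedArguments]
def DualMotive (_φ : AndersonModule Fq A L d) : Type _ := Fin d → LTau Fq L

instance : AddCommGroup φ.Motive := inferInstanceAs (AddCommGroup (Fin d → LTau Fq L))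
instance : Module Fq φ.Motive := inferInstanceAs (Module Fq (Fin d → LTau Fq L))
instance : AddCommGroup φ.DualMotive := inferInstanceAs (AddCommGroup (Fin d → LTau Fq L))
instance : Module Fq φ.DualMotive := inferInstanceAs (Module Fq (Fin d → LTau Fq L))

/-- `ℓ ∈ L` acts on `M` by `m ↦ ℓ m`. -/
def motiveL (_φ : AndersonModule Fq A L d) : L →ₐ[Fq] Module.End Fq (Fin d → LTau Fq L) where
  toFun l :=
    { toFun := fun m k => SkewPoly.C l * m k
      map_add' := fun m m' => funext fun k => mul_add _ _ _
      map_smul' := fun c m => funext fun k => mul_smul_comm c (SkewPoly.C l) (m k) }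
  map_one' := by refine LinearMap.ext fun m => ?_; funext k; simp
  map_mul' l l' := by refine LinearMap.ext fun m => ?_; funext k; simp [mul_assoc]
  map_zero' := by refine LinearMap.ext fun m => ?_; funext k; simp
  map_add' l l' := by refine LinearMap.ext fun m => ?_; funext k; simp [add_mul]
  commutes' c := by refine LinearMap.ext fun m => ?_; funext k; exact (Algebra.smul_def c (m k)).symm

/-- `a ∈ A` acts on `M` by `m ↦ m ∘ φ a`. -/
def motiveA : A →ₐ[Fq] Module.End Fq (Fin d → LTau Fq L) where
  toFun a :=
    { toFun := fun m => Matrix.vecMul m (φ.toAlgHom a)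
      map_add' := fun m m' => Matrix.add_vecMul _ _ _
      map_smul' := fun c m => Matrix.smul_vecMul _ _ _ }
  map_one' := by refine LinearMap.ext fun m => ?_; simp
  map_mul' a b := by refine LinearMap.ext fun m => ?_; rw [mul_comm]; simp [Matrix.vecMul_vecMul]
  map_zero' := by refine LinearMap.ext fun m => ?_; simp
  map_add' a b := by refine LinearMap.ext fun m => ?_; simp [Matrix.vecMul_add]
  commutes' c := by
    refine LinearMap.ext fun m => ?_
    simp [Algebra.algebraMap_eq_smul_one, Matrix.vecMul_smul]

/-- `τ` acts on `M` by `m ↦ τ m`. -/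
def tau : φ.Motive →+ φ.Motive where
  toFun m k := SkewPoly.X * m k
  map_zero' := funext fun _ => mul_zero _
  map_add' _ _ := funext fun _ => mul_add _ _ _

/-- `ℓ ∈ L` acts on `N` by `n ↦ n ∘ ℓ`. -/
def dualMotiveL (_φ : AndersonModule Fq A L d) :
    L →ₐ[Fq] Module.End Fq (Fin d → LTau Fq L) where
  toFun l :=
    { toFun := fun n k => n k * SkewPoly.C l
      map_add' := fun n n' => funext fun k => add_mul _ _ _
      map_smul' := fun c n => funext fun k => smul_mul_assoc c (n k) (SkewPoly.C l) }
  map_one' := by refine LinearMap.ext fun m => ?_; funext k; simp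
  map_mul' l l' := by refine LinearMap.ext fun m => ?_; funext k; rw [mul_comm]; simp [mul_assoc]
  map_zero' := by refine LinearMap.ext fun m => ?_; funext k; simp
  map_add' l l' := by refine LinearMap.ext fun m => ?_; funext k; simp [mul_add]
  commutes' c := by
    refine LinearMap.ext fun n => ?_
    funext k
    exact ((Algebra.smul_def c (n k)).trans (Algebra.commutes c (n k))).symm

/-- `a ∈ A` acts on `N` by `n ↦ φ a ∘ n`. -/
def dualMotiveA : A →ₐ[Fq] Module.End Fq (Fin d → LTau Fq L) where
  toFun a :=
    { toFun := fun n => Matrix.mulVec (φ.toAlgHom a) n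
      map_add' := fun n n' => Matrix.mulVec_add _ _ _
      map_smul' := fun c n => Matrix.mulVec_smul _ _ _ }
  map_one' := by refine LinearMap.ext fun n => ?_; simp
  map_mul' a b := by refine LinearMap.ext fun n => ?_; simp
  map_zero' := by refine LinearMap.ext fun n => ?_; simp
  map_add' a b := by refine LinearMap.ext fun n => ?_; simp [Matrix.add_mulVec]
  commutes' c := by
    refine LinearMap.ext fun n => ?_
    simp [Algebra.algebraMap_eq_smul_one, Matrix.smul_mulVec]

/-- `σ` acts on `N` by `n ↦ n τ`. -/
def sigma : φ.DualMotive →+ φ.DualMotive where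
  toFun n k := n k * SkewPoly.X
  map_zero' := funext fun _ => zero_mul _
  map_add' _ _ := funext fun _ => add_mul _ _ _

theorem motive_commute (l : L) (a : A) : Commute (φ.motiveL l) (φ.motiveA a) :=
  LinearMap.ext fun m => by
    funext k
    simp [motiveL, motiveA, Matrix.vecMul, dotProduct, Finset.mul_sum, mul_assoc]

theorem dualMotive_commute (l : L) (a : A) : Commute (φ.dualMotiveL l) (φ.dualMotiveA a) :=
  LinearMap.ext fun n => by
    funext k
    simp [dualMotiveL, dualMotiveA, Matrix.mulVec, dotProduct, Finset.sum_mul, mul_assoc]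

/-- `L ⊗ A` acts on `M` by `(ℓ ⊗ a) m = ℓ m ∘ φ a`. -/
instance : Module (LA Fq A L) φ.Motive :=
  Module.compHom (Fin d → LTau Fq L)
    (Algebra.TensorProduct.lift φ.motiveL φ.motiveA φ.motive_commute).toRingHom

/-- `L ⊗ A` acts on `N` by `(ℓ ⊗ a) n = φ a ∘ n ∘ ℓ`. -/
instance : Module (LA Fq A L) φ.DualMotive :=
  Module.compHom (Fin d → LTau Fq L)
    (Algebra.TensorProduct.lift φ.dualMotiveL φ.dualMotiveA φ.dualMotive_commute).toRingHom

/-- `L` acts on `M` through `L ⊗ 1`. -/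
instance : Module L φ.Motive :=
  Module.compHom φ.Motive (Algebra.TensorProduct.includeLeft : L →ₐ[Fq] LA Fq A L).toRingHom

/-- `L` acts on `N` through `L ⊗ 1`. -/
instance : Module L φ.DualMotive :=
  Module.compHom φ.DualMotive (Algebra.TensorProduct.includeLeft : L →ₐ[Fq] LA Fq A L).toRingHom

theorem tmul_smul_motive (l : L) (a : A) (m : φ.Motive) :
    (l ⊗ₜ[Fq] a : LA Fq A L) • m = φ.motiveL l (φ.motiveA a m) := by
  change (Algebra.TensorProduct.lift φ.motiveL φ.motiveA φ.motive_commute) (l ⊗ₜ a) m = _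
  rw [Algebra.TensorProduct.lift_tmul]
  rfl

theorem tmul_smul_dualMotive (l : L) (a : A) (n : φ.DualMotive) :
    (l ⊗ₜ[Fq] a : LA Fq A L) • n = φ.dualMotiveL l (φ.dualMotiveA a n) := by
  change (Algebra.TensorProduct.lift φ.dualMotiveL φ.dualMotiveA φ.dualMotive_commute)
    (l ⊗ₜ a) n = _
  rw [Algebra.TensorProduct.lift_tmul]
  rfl

theorem X_mul_vecMul (a : A) (l : L) (m : Fin d → LTau Fq L) (k : Fin d) :
    SkewPoly.X * (SkewPoly.C l * Matrix.vecMul m (φ.toAlgHom a) k) =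
      SkewPoly.C (frob Fq L l) *
        Matrix.vecMul (fun j => SkewPoly.X * m j) (φ.toAlgHom a) k := by
  rw [← mul_assoc, SkewPoly.X_mul_C]
  simp [Matrix.vecMul, dotProduct, Finset.mul_sum, mul_assoc]

theorem mulVec_mul_X (a : A) (l : L) (n : Fin d → LTau Fq L) (k : Fin d) :
    Matrix.mulVec (φ.toAlgHom a) n k * SkewPoly.C l * SkewPoly.X =
      Matrix.mulVec (φ.toAlgHom a) (fun j => n j * SkewPoly.X) k *
        SkewPoly.C ((frob Fq L).symm l) := by
  have h : (SkewPoly.X * SkewPoly.C ((frob Fq L).symm l) : LTau Fq L) =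
      SkewPoly.C l * SkewPoly.X := by
    rw [SkewPoly.X_mul_C]
    simp
  simp [Matrix.mulVec, dotProduct, Finset.sum_mul, mul_assoc, h]

theorem tau_smul (s : LA Fq A L) (m : φ.Motive) : φ.tau (s • m) = twist Fq A L s • φ.tau m := by
  induction s using TensorProduct.induction_on with
  | zero => simp
  | add s t hs ht => rw [add_smul, map_add, hs, ht, map_add, add_smul]
  | tmul l a =>
    have e : twist Fq A L (l ⊗ₜ[Fq] a) = frob Fq L l ⊗ₜ[Fq] a := by simp [twist]
    rw [e, tmul_smul_motive, tmul_smul_motive]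
    funext k
    exact φ.X_mul_vecMul a l m k

theorem sigma_smul (s : LA Fq A L) (n : φ.DualMotive) :
    φ.sigma (s • n) = (twist Fq A L).symm s • φ.sigma n := by
  induction s using TensorProduct.induction_on with
  | zero => simp
  | add s t hs ht => rw [add_smul, map_add, hs, ht, map_add, add_smul]
  | tmul l a =>
    have e : (twist Fq A L).symm (l ⊗ₜ[Fq] a) = (frob Fq L).symm l ⊗ₜ[Fq] a := by
      rw [AlgEquiv.symm_apply_eq]
      simp [twist]
    rw [e, tmul_smul_dualMotive, tmul_smul_dualMotive]
    funext k
    exact φ.mulVec_mul_X a l n k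

/-- `φ` is abelian of rank `r`: `M` is a finitely generated projective `L ⊗ A`-module of constant
local rank `r`. -/
structure IsAbelian (r : ℕ) : Prop where
  finite : Module.Finite (LA Fq A L) φ.Motive
  projective : Module.Projective (LA Fq A L) φ.Motive
  rank : ∀ P : PrimeSpectrum (LA Fq A L), Module.rankAtStalk φ.Motive P = r

/-! ### Generic fibres -/

/-- `M_K`, the base change of `M` to the function field. -/
abbrev MotiveK : Type _ := LK Fq A L ⊗[LA Fq A L] φ.Motive

/-- `N_K`, the base change of `N` to the function field. -/
abbrev DualMotiveK : Type _ := LK Fq A L ⊗[LA Fq A L] φ.DualMotive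

/-- `τ` on `M_K`: `f ⊗ m ↦ f^{(1)} ⊗ τ m`. -/
def tauK : φ.MotiveK →+ φ.MotiveK :=
  TensorProduct.liftAddHom
    { toFun := fun f =>
        ((TensorProduct.mk (LA Fq A L) (LK Fq A L) φ.Motive (twistK Fq A L f)).toAddMonoidHom.comp
          φ.tau)
      map_zero' := by
        refine AddMonoidHom.ext fun m => ?_
        change (twistK Fq A L 0 ⊗ₜ φ.tau m : φ.MotiveK) = 0
        rw [RingEquiv.map_zero, TensorProduct.zero_tmul]
      map_add' := fun f f' => by
        refine AddMonoidHom.ext fun m => ?_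
        change (twistK Fq A L (f + f') ⊗ₜ φ.tau m : φ.MotiveK) =
          twistK Fq A L f ⊗ₜ φ.tau m + twistK Fq A L f' ⊗ₜ φ.tau m
        rw [RingEquiv.map_add, TensorProduct.add_tmul] }
    (fun s f m => by
      change (twistK Fq A L (s • f) ⊗ₜ φ.tau m : φ.MotiveK) = twistK Fq A L f ⊗ₜ φ.tau (s • m)
      rw [tau_smul, ← TensorProduct.smul_tmul, Algebra.smul_def, Algebra.smul_def,
        RingEquiv.map_mul, twistK_algebraMap])

/-- `σ` on `N_K`: `f ⊗ n ↦ f^{(-1)} ⊗ σ n`. -/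
def sigmaK : φ.DualMotiveK →+ φ.DualMotiveK :=
  TensorProduct.liftAddHom
    { toFun := fun f =>
        ((TensorProduct.mk (LA Fq A L) (LK Fq A L) φ.DualMotive
          ((twistK Fq A L).symm f)).toAddMonoidHom.comp φ.sigma)
      map_zero' := by
        refine AddMonoidHom.ext fun n => ?_
        change ((twistK Fq A L).symm 0 ⊗ₜ φ.sigma n : φ.DualMotiveK) = 0
        rw [RingEquiv.map_zero, TensorProduct.zero_tmul]
      map_add' := fun f f' => by
        refine AddMonoidHom.ext fun n => ?_
        change ((twistK Fq A L).symm (f + f') ⊗ₜ φ.sigma n : φ.DualMotiveK) =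
          (twistK Fq A L).symm f ⊗ₜ φ.sigma n + (twistK Fq A L).symm f' ⊗ₜ φ.sigma n
        rw [RingEquiv.map_add, TensorProduct.add_tmul] }
    (fun s f n => by
      change ((twistK Fq A L).symm (s • f) ⊗ₜ φ.sigma n : φ.DualMotiveK) =
        (twistK Fq A L).symm f ⊗ₜ φ.sigma (s • n)
      rw [sigma_smul, ← TensorProduct.smul_tmul, Algebra.smul_def, Algebra.smul_def,
        RingEquiv.map_mul, twistK_symm_algebraMap])

/-- Bases `c` of `M_K` and `d` of `N_K` over the function field in which `τ` and `σ` are given by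
transposed matrices: `τ cᵢ = ∑ⱼ Φᵢⱼ cⱼ` and `σ dᵢ = ∑ⱼ Φⱼᵢ dⱼ`. -/
structure MotivicBases (r : ℕ) where
  /-- The basis of `M_K`. -/
  c : Module.Basis (Fin r) (LK Fq A L) φ.MotiveK
  /-- The basis of `N_K`. -/
  d : Module.Basis (Fin r) (LK Fq A L) φ.DualMotiveK
  /-- The matrix of `τ`. -/
  Φ : Matrix (Fin r) (Fin r) (LK Fq A L)
  tau_c : ∀ i, φ.tauK (c i) = ∑ j, Φ i j • c j
  sigma_d : ∀ i, φ.sigmaK (d i) = ∑ j, Φ j i • d j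

namespace MotivicBases

variable {φ} {r : ℕ} (B : φ.MotivicBases r)

/-- `Ξ`-regularity: the entries and the determinant of `Φ` are regular at all twists of `Ξ`. -/
def IsXiRegular : Prop :=
  ∀ i : ℤ, RegularAt B.Φ.det i ∧ ∀ j k, RegularAt (B.Φ j k) i

/-- `τ⁻¹` on `M_K`: in the coordinates given by `c`, it sends the column vector `a` to
`((Φ⁻¹)ᵀ)^{(-1)} a^{(-1)}`. -/
def tauInv (u : φ.MotiveK) : φ.MotiveK :=
  ∑ k, ((B.Φ⁻¹.transpose.map (twistK Fq A L).symm).mulVec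
    (fun j => (twistK Fq A L).symm (B.c.repr u j))) k • B.c k

end MotivicBases

/-- Bases `g` of `M` over `L[τ]` and `h` of `N` over `L[σ]` (that is, the `τⁱ gₖ` form a basis of
`M` over `L` and the `σⁱ hₖ` form a basis of `N` over `L`) such that each `a ∈ A` acts on `g` by the
matrix `φ a` and on `h` by the matrix `(φ a)*`. -/
structure AdaptedBases where
  /-- The basis of `M` over `L[τ]`. -/
  g : Fin d → φ.Motive
  /-- The basis of `N` over `L[σ]`. -/
  h : Fin d → φ.DualMotive
  /-- The basis `τⁱ gₖ` of `M` over `L`. -/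
  gBasis : Module.Basis (Fin d × ℕ) L φ.Motive
  /-- The basis `σⁱ hₖ` of `N` over `L`. -/
  hBasis : Module.Basis (Fin d × ℕ) L φ.DualMotive
  gBasis_apply : ∀ k i, gBasis (k, i) = φ.tau^[i] (g k)
  hBasis_apply : ∀ k i, hBasis (k, i) = φ.sigma^[i] (h k)
  smul_g : ∀ (a : A) (k : Fin d),
    ((1 : L) ⊗ₜ[Fq] a : LA Fq A L) • g k = ∑ l, (φ.toAlgHom a k l).act φ.tau (g l)
  smul_h : ∀ (a : A) (k : Fin d),
    ((1 : L) ⊗ₜ[Fq] a : LA Fq A L) • h k = ∑ l, (starMap (φ.toAlgHom a l k)).act φ.sigma (h l)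

/-! ### The maps `δ` -/

/-- `u ∈ M_K` is regular at `Ξ`: it lies in the localization of `M` at the point `Ξ`. -/
def IsRegularAtXi (u : φ.MotiveK) : Prop :=
  ∃ s : LA Fq A L, s ∉ idealJ Fq A L ∧ ∃ m : φ.Motive, s • u = 1 ⊗ₜ m

/-- `u ∈ M_K` is congruent to `m ∈ M` modulo `J^d`, locally at `Ξ`. -/
def IsCongrModJ (u : φ.MotiveK) (m : φ.Motive) : Prop :=
  ∃ s : LA Fq A L, s ∉ idealJ Fq A L ∧
    ∃ n ∈ (idealJ Fq A L ^ d • ⊤ : Submodule (LA Fq A L) φ.Motive), s • (u - 1 ⊗ₜ m) = 1 ⊗ₜ n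

namespace AdaptedBases

variable {φ} (E : φ.AdaptedBases)

/-- `δ₀^M : M → L^d`, the coefficients of the `gₖ` in `m = ∑ c_{k,i} τⁱ gₖ`. -/
def delta0 (m : φ.Motive) : Fin d → L := fun k => E.gBasis.repr m (k, 0)

open Classical in
/-- The extension of `δ₀^M` to the elements of `M_K` that are regular at `Ξ`, through the
identification of `M / J^d M` with its localization at `Ξ`. -/
def delta0K (u : φ.MotiveK) : Fin d → L :=
  if hu : ∃ m, φ.IsCongrModJ u m then E.delta0 hu.choose else 0

/-- The map `n ↦ (c_{k,j})` for `n = ∑ c_{k,j} σʲ hₖ` in `N`. -/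
def coord (n : φ.DualMotive) (k : Fin d) (j : ℕ) : L := E.hBasis.repr n (k, j)

variable {r : ℕ} (B : φ.MotivicBases r)

/-- The term `∑ₖ δ₀^M(τ⁻ⁱ(x gₖ))ᵀ z σⁱ(y hₖ)` of the pairing, an element of `N`. -/
def term (x : LATau Fq A L) (y : LASigma Fq A L) (z : Fin d → L) (i : ℕ) : φ.DualMotive :=
  ∑ k, (E.delta0K (B.tauInv^[i] (1 ⊗ₜ x.act φ.tau (E.g k))) ⬝ᵥ z) •
    φ.sigma^[i] (y.act φ.sigma (E.h k))

/-- The sum of all the terms in `N ⊗ L[[σ]]`, where an element `∑ c_{k,j} σʲ hₖ` is represented by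
its coefficients `c_{k,j}`. -/
def series (x : LATau Fq A L) (y : LASigma Fq A L) (z : Fin d → L) (k : Fin d) (j : ℕ) : L :=
  ∑ᶠ i : ℕ, E.coord (E.term B x y z i) k j

end AdaptedBases

section Analytic

variable (Cinf : Type*) [NormedField Cinf] [Algebra L Cinf]

variable (Fq) in
/-- `w^{(j)}`: the coordinatewise `q^j`-th power. -/
def twistVec {R : Type*} [CommRing R] {d : ℕ} (j : ℕ) (w : Fin d → R) : Fin d → R :=
  fun k => w k ^ Fintype.card Fq ^ j

variable (Fq) in
/-- `∑ c_{k,j} σʲ hₖ` belongs to `N[[σ]]`: the vectors `(c_{1,j}, …, c_{d,j})^{(j)}` tend to `0`. -/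
def MemNSigma {d : ℕ} (c : Fin d → ℕ → L) : Prop :=
  Filter.Tendsto (fun j => twistVec Fq j fun k => algebraMap L Cinf (c k j)) Filter.atTop (𝓝 0)

variable (Fq) in
/-- `δ₁^N` on `N[[σ]]`: the sum of the vectors `(c_{1,j}, …, c_{d,j})^{(j)}`. -/
def delta1 {d : ℕ} (c : Fin d → ℕ → L) : Fin d → Cinf :=
  ∑' j, twistVec Fq j fun k => algebraMap L Cinf (c k j)

/-- The pairing `F(x, y; z)`. -/
def AdaptedBases.pairing {φ : AndersonModule Fq A L d} (E : φ.AdaptedBases) {r : ℕ}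
    (B : φ.MotivicBases r) (x : LATau Fq A L) (y : LASigma Fq A L) (z : Fin d → L) :
    Fin d → Cinf :=
  delta1 Fq Cinf (E.series B x y z)

/-- `∑ Qᵢ z^{(i)}` is the exponential series of `φ`: `Q₀ = 1`, and `Exp(d[a] z) = φ a (Exp z)` as
formal power series, for all `a ∈ A`. -/
structure IsExponential (Q : ℕ → Matrix (Fin d) (Fin d) Cinf) : Prop where
  zero : Q 0 = 1
  functional : ∀ (a : A) (n : ℕ),
    Q n * (φ.lie a).map (fun x => algebraMap L Cinf x ^ Fintype.card Fq ^ n) =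
      ∑ p ∈ Finset.HasAntidiagonal.antidiagonal n, (φ.coeff a p.1).map (algebraMap L Cinf) *
        (Q p.2).map (fun x => x ^ Fintype.card Fq ^ p.1)

end Analytic

end AndersonModule

end Motives

/-! ### The curve and the field `ℂ_∞` -/

/-- `Spec A` is the complement of the `Fq`-rational point `∞` in a smooth projective geometrically
connected curve over `Fq` with function field `K`, and `V` is the local ring of `∞`: `Spec A` is a
regular integral affine curve with fraction field `K`, and `V` is the only place of `K` that is
not centred on `Spec A`. Places of `K` are its nontrivial valuation subrings. -/
structure IsCurveMinusPoint {Fq K : Type*} [Field Fq] [Field K] [Algebra Fq K]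
    (A : Subalgebra Fq K) (V : ValuationSubring K) : Prop where
  finiteType : Algebra.FiniteType Fq A
  isFractionRing : IsFractionRing A K
  isDedekindDomain : IsDedekindDomain A
  not_isField : ¬ IsField A
  ne_top : V ≠ ⊤
  not_le_iff : ∀ W : ValuationSubring K, W ≠ ⊤ → (¬ (A : Set K) ⊆ W ↔ W = V)
  rational : ∀ x ∈ V, ∃ c : Fq, V.valuation (x - algebraMap Fq K c) < 1

/-- The closure of `K` in `C`; it is the completion of `K` at the place that defines the norm. -/
def closureIn (K C : Type*) [Field K] [NormedField C] [Algebra K C] : Subfield C :=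
  (algebraMap K C).fieldRange.topologicalClosure

/-- `C` is the completion of an algebraic closure of the completion `K_∞` of `K` at the place `V`:
it is complete and nonarchimedean, its norm defines `V` on `K`, and the algebraic elements over
`K_∞` form a dense algebraically closed subfield. -/
structure IsCompletedAlgClosure {K : Type*} [Field K] (V : ValuationSubring K)
    (C : Type*) [NormedField C] [Algebra K C] : Prop where
  completeSpace : CompleteSpace C
  isUltrametricDist : IsUltrametricDist C
  norm_le_one_iff : ∀ x : K, ‖algebraMap K C x‖ ≤ 1 ↔ x ∈ V
  isAlgClosed : IsAlgClosed (algebraicClosure (closureIn K C) C)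
  dense : Dense (algebraicClosure (closureIn K C) C : Set C)

end

set_option linter.unusedSectionVars false

noncomputable section

/-! ### Bases consisting of the iterates of a semilinear map -/

section SemilinearBasis

variable {L V ι : Type*} [Field L] [AddCommGroup V] [Module L V] {θ : L ≃+* L} {T : V →+ V}
  {g : ι → V} {b : Module.Basis (ι × ℕ) L V}

/-! Everything is read off from the matrices `Dₙ` whose rows are `δ₀(τ⁻ⁿ gₖ)` (`deltaIter`). Since
`τ⁻ⁿ` is semilinear and commutes with `A`, while `δ₀` kills `τM` and turns `a` into right
multiplication by `d[a]`, applying `δ₀ τ⁻ⁿ` to `a g = ∑ A_p τᵖ g` yields `Dₙ d[a] = ∑_{p ≤ n}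
A_p^{(-n)} D_{n-p}`. Twisting `n` times shows that `Qₙ = Dₙ^{(n)}` solves the functional equation
(`expCoeff_functional`). For `x = y = 1` the coefficient of `σʲ hₖ` in the pairing is entry `k` of
`Dⱼ z` (`series_one_one`), and `δ₁` sums `(Dⱼ z)^{(j)} = Qⱼ z^{(j)}`.

The remaining points are settled by a single element of `A`. Take `b ∈ A` with a pole at `∞`. On
`M/τM ≅ L^d` the element `1 ⊗ b - b ⊗ 1` is nilpotent, so in characteristic `p` a power `a =
b^{q^N}`, with image `θ` in `L`, makes `e = 1 ⊗ a - θ ⊗ 1` map `M` into `τM`; in particular `d[a] =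
θ`. As `e` is a nonzerodivisor, `τ` is bijective on `M_K`. The product of the `e^{(-i)}`, `1 ≤ i ≤
n`, clears the denominators of `τ⁻ⁿ m`, and their values `θ - θ^{(-i)}` at `Ξ` are nonzero, whence
regularity.

For this `a` the recursion reads `(θ - θ^{(-n)}) Dₙ = ∑_{p ≥ 1} A_p^{(-n)} D_{n-p}`. Iterated `q`-th
roots have norm at most any fixed bound `> 1` eventually, whereas `|θ| > 1`; so `Dₙ` is smaller by a
constant factor than the largest of boundedly many predecessors, and `Dₙ → 0`
(`tendsto_deltaIter_g`). All convergence claims follow. Uniqueness holds because `(θ^{q^n} - θ) Qₙ`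
is determined by the earlier coefficients. -/

theorem Module.Basis.induction_of_smul {κ : Type*} (b : Module.Basis κ L V) {P : V → Prop}
    (h0 : P 0)
    (hadd : ∀ v w, P v → P w → P (v + w)) (hs : ∀ (c : L) i, P (c • b i))
    (v : V) : P v := by
  rw [← b.linearCombination_repr v, Finsupp.linearCombination_apply, Finsupp.sum]
  exact Finset.sum_induction _ P hadd h0 fun i _ => hs _ i

theorem repr_semilinear_zero (hT : ∀ l v, T (l • v) = θ l • T v)
    (hb : ∀ k i, b (k, i) = T^[i] (g k)) (v : V) (k : ι) : b.repr (T v) (k, 0) = 0 := by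
  classical
  induction v using b.induction_of_smul with
  | h0 => simp
  | hadd v w hv hw => simp [hv, hw]
  | hs c i =>
    rw [hT, show T (b i) = b (i.1, i.2 + 1) by
      rw [hb i.1 (i.2 + 1), Function.iterate_succ_apply', ← hb]]
    simp

theorem repr_semilinear_succ (hT : ∀ l v, T (l • v) = θ l • T v)
    (hb : ∀ k i, b (k, i) = T^[i] (g k)) (v : V) (k : ι) (j : ℕ) :
    b.repr (T v) (k, j + 1) = θ (b.repr v (k, j)) := by
  classical
  induction v using b.induction_of_smul with
  | h0 => simp
  | hadd v w hv hw => simp [hv, hw]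
  | hs c i =>
    rw [hT, show T (b i) = b (i.1, i.2 + 1) by
      rw [hb i.1 (i.2 + 1), Function.iterate_succ_apply', ← hb]]
    obtain ⟨i, m⟩ := i
    simp [Finsupp.single_apply, apply_ite θ]

theorem repr_iterate_semilinear (hT : ∀ l v, T (l • v) = θ l • T v)
    (hb : ∀ k i, b (k, i) = T^[i] (g k)) (n : ℕ) (v : V) (k : ι) (j : ℕ) :
    b.repr (T^[n] v) (k, j) = if n ≤ j then θ^[n] (b.repr v (k, j - n)) else 0 := by
  induction n generalizing j with
  | zero => simp
  | succ n ih =>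
    rw [Function.iterate_succ_apply']
    cases j with
    | zero => simp [repr_semilinear_zero hT hb]
    | succ j =>
      rw [repr_semilinear_succ hT hb, ih]
      by_cases h : n ≤ j
      · simp [h, Function.iterate_succ_apply']
      · simp [h]

theorem exists_semilinear_eq (hT : ∀ l v, T (l • v) = θ l • T v)
    (hb : ∀ k i, b (k, i) = T^[i] (g k)) (v : V) (hv : ∀ k, b.repr v (k, 0) = 0) :
    ∃ w, T w = v := by
  have hinj : Function.Injective fun x : ι × ℕ => (x.1, x.2 + 1) := by
    rintro ⟨a, i⟩ ⟨c, j⟩ h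
    simpa using h
  -- The preimage has the coefficients of `v` moved down by one index and untwisted; only those at
  -- index `0` get lost, and they vanish.
  refine ⟨b.repr.symm (((b.repr v).comapDomain _ hinj.injOn).mapRange θ.symm (map_zero _)), ?_⟩
  refine b.ext_elem ?_
  rintro ⟨k, _ | j⟩
  · rw [repr_semilinear_zero hT hb, hv]
  · rw [repr_semilinear_succ hT hb]
    simp

end SemilinearBasis

namespace SkewPoly

variable {k R : Type*} [CommRing k] [CommRing R] [Algebra k R] {θ : R →ₐ[k] R}
  {M : Type*} [AddCommMonoid M] [Module R M]

theorem one_act (T : M → M) (m : M) : (1 : SkewPoly k R θ).act T m = m := by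
  refine (SkewMonoidAlgebra.sum_single_index (k := Twisted k R θ) ?_).trans ?_
  · exact zero_smul R _
  · exact one_smul R _

theorem exists_act_eq_sum (p : SkewPoly k R θ) :
    ∃ s : Finset ℕ, (∀ i ∉ s, p.coeff i = 0) ∧
      ∀ (T : M → M) (m : M), p.act T m = ∑ i ∈ s, p.coeff i • T^[i] m :=
  ⟨SkewPolynomial.support (R := Twisted k R θ) p,
    fun _ hi => SkewPolynomial.notMem_support_iff.1 hi,
    fun T m => SkewPolynomial.sum_def (R := Twisted k R θ) p fun i (a : R) => a • T^[i] m⟩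

end SkewPoly

/-! ### Iterated Frobenius twists and the point `Ξ` -/

section Motives

variable {Fq A L : Type*} [Field Fq] [Fintype Fq] [CommRing A] [Algebra Fq A]
  [Field L] [Algebra Fq L] [IsAlgClosed L]

theorem twist_tmul (l : L) (a : A) : twist Fq A L (l ⊗ₜ a) = frob Fq L l ⊗ₜ a := by
  simp [twist]

theorem twist_symm_tmul (l : L) (a : A) :
    (twist Fq A L).symm (l ⊗ₜ a) = (frob Fq L).symm l ⊗ₜ a := by
  rw [AlgEquiv.symm_apply_eq, twist_tmul, AlgEquiv.apply_symm_apply]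

theorem twist_symm_iterate_tmul (n : ℕ) (l : L) (a : A) :
    (twist Fq A L).symm^[n] (l ⊗ₜ a) = (frob Fq L).symm^[n] l ⊗ₜ a := by
  induction n with
  | zero => rfl
  | succ n ih => rw [Function.iterate_succ_apply', ih, twist_symm_tmul,
      Function.iterate_succ_apply' _ n l]

theorem iterate_frob_apply (n : ℕ) (x : L) : (frob Fq L)^[n] x = x ^ Fintype.card Fq ^ n := by
  induction n with
  | zero => simp
  | succ n ih => rw [Function.iterate_succ_apply', ih, frob_apply, ← pow_mul, pow_succ]

theorem iterate_frob_symm_pow (n : ℕ) (x : L) :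
    ((frob Fq L).symm^[n] x) ^ Fintype.card Fq ^ n = x := by
  rw [← iterate_frob_apply]
  exact Function.LeftInverse.iterate (frob Fq L).apply_symm_apply n x

/-! ### The point `Ξ` -/

section Point

variable [Algebra A L] [IsScalarTower Fq A L]

variable (Fq A L) in
/-- The evaluation `ℓ ⊗ a ↦ ℓ a` of `L ⊗ A` at the point `Ξ`. -/
def evalXi : LA Fq A L →ₐ[Fq] L :=
  Algebra.TensorProduct.lift (AlgHom.id Fq L) (IsScalarTower.toAlgHom Fq A L)
    fun _ _ => Commute.all _ _

theorem evalXi_tmul (l : L) (a : A) : evalXi Fq A L (l ⊗ₜ a) = l * algebraMap A L a := by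
  simp [evalXi]

/-- Modulo `J`, `ℓ ⊗ a` becomes `ℓa ⊗ 1`. Thus `J` is the kernel of `evalXi`, and lying outside `J`
means that one element of the field `L` is nonzero. -/
theorem sub_evalXi_mem (s : LA Fq A L) : s - evalXi Fq A L s ⊗ₜ 1 ∈ idealJ Fq A L := by
  induction s using TensorProduct.induction_on with
  | zero => simp
  | add s t hs ht =>
    rw [map_add, TensorProduct.add_tmul, add_sub_add_comm]
    exact add_mem hs ht
  | tmul l a =>
    have h : (1 : L) ⊗ₜ[Fq] a - algebraMap A L a ⊗ₜ[Fq] (1 : A) ∈ idealJ Fq A L :=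
      Ideal.subset_span ⟨a, rfl⟩
    have := Ideal.mul_mem_left _ (l ⊗ₜ[Fq] (1 : A)) h
    rw [mul_sub, Algebra.TensorProduct.tmul_mul_tmul, Algebra.TensorProduct.tmul_mul_tmul] at this
    simpa [evalXi_tmul] using this

theorem mem_idealJ_iff (s : LA Fq A L) : s ∈ idealJ Fq A L ↔ evalXi Fq A L s = 0 := by
  constructor
  · intro h
    have : idealJ Fq A L ≤ RingHom.ker (evalXi Fq A L) := by
      refine Ideal.span_le.2 ?_
      rintro _ ⟨a, rfl⟩
      simp [evalXi_tmul]
    exact this h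
  · intro h
    simpa [h] using sub_evalXi_mem s

theorem mul_notMem_idealJ {s t : LA Fq A L} (hs : s ∉ idealJ Fq A L) (ht : t ∉ idealJ Fq A L) :
    s * t ∉ idealJ Fq A L := by
  rw [mem_idealJ_iff] at *
  simp [hs, ht]

theorem one_notMem_idealJ : (1 : LA Fq A L) ∉ idealJ Fq A L := by
  simp [mem_idealJ_iff]

/-- An element that does not vanish at `Ξ` is a unit modulo `J`, hence modulo every power of `J`.
This is why localizing at `Ξ` does not change `M / J^d M`. -/
theorem exists_one_sub_mul_mem_pow {s : LA Fq A L} (hs : s ∉ idealJ Fq A L) (n : ℕ) :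
    ∃ t, 1 - s * t ∈ idealJ Fq A L ^ n := by
  rw [mem_idealJ_iff] at hs
  set t : LA Fq A L := (evalXi Fq A L s)⁻¹ ⊗ₜ 1
  have h : 1 - s * t ∈ idealJ Fq A L := by
    rw [mem_idealJ_iff]
    simp [t, evalXi_tmul, hs]
  -- The factorization `1 - (1 - st)ⁿ = st · u` improves the inverse `t` modulo `J` to the inverse
  -- `tu` modulo `Jⁿ`.
  obtain ⟨u, hu⟩ := sub_dvd_pow_sub_pow (1 : LA Fq A L) (1 - s * t) n
  refine ⟨t * u, ?_⟩
  have : 1 - s * (t * u) = (1 - s * t) ^ n := by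
    rw [one_pow] at hu
    linear_combination hu
  rw [this]
  exact Ideal.pow_mem_pow h n

end Point

/-! ### A nonzerodivisor -/

/-- The coordinate functionals of an `Fq`-basis of `L` already separate the elements of `L ⊗ A`. -/
theorem exists_dual_rTensor_ne_zero {u : LA Fq A L} (hu : u ≠ 0) :
    ∃ f : L →ₗ[Fq] Fq, TensorProduct.lid Fq A (f.rTensor A u) ≠ 0 := by
  classical
  by_contra! h
  apply hu
  let b := Module.Basis.ofVectorSpace Fq L
  refine (TensorProduct.equivFinsuppOfBasisLeft (N := A) b).injective (Finsupp.ext fun i => ?_)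
  have key : ∀ v : LA Fq A L, TensorProduct.equivFinsuppOfBasisLeft b v i =
      TensorProduct.lid Fq A ((b.coord i).rTensor A v) := by
    intro v
    induction v using TensorProduct.induction_on with
    | zero => simp
    | add s t hs ht => simp [hs, ht]
    | tmul l a => simp
  rw [key, h]
  simp

/-- If `u` is killed, then `u (1 ⊗ a) = u (θ ⊗ 1)`, so the contractions of `u` against functionals
on `L` form a subspace of `A` stable under `a`. It is a finite set, while multiplication by `a`
increases norms, so it is zero. -/
theorem one_tmul_sub_tmul_one_mem_nonZeroDivisors {C : Type*} [NormedField C] (ν : A →+* C)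
    (hν : Function.Injective ν) (a : A) (ha : 1 < ‖ν a‖) (θ : L) :
    (1 : L) ⊗ₜ[Fq] a - θ ⊗ₜ[Fq] (1 : A) ∈ nonZeroDivisors (LA Fq A L) := by
  rw [mem_nonZeroDivisors_iff_right]
  classical
  intro u hu
  by_contra hu0
  let W : (L →ₗ[Fq] Fq) →ₗ[Fq] A :=
    { toFun := fun f => TensorProduct.lid Fq A (f.rTensor A u)
      map_add' := fun f f' => by simp [LinearMap.rTensor_add]
      map_smul' := fun c f => by simp [LinearMap.rTensor_smul] }
  have hmul : ∀ (v : LA Fq A L) (f : L →ₗ[Fq] Fq),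
      TensorProduct.lid Fq A (f.rTensor A (v * (1 : L) ⊗ₜ[Fq] a)) =
        a * TensorProduct.lid Fq A (f.rTensor A v) := by
    intro v f
    induction v using TensorProduct.induction_on with
    | zero => simp
    | add s t hs ht => rw [add_mul, map_add, map_add, hs, ht, map_add, map_add, mul_add]
    | tmul l b => simp [mul_comm]
  have hmul' : ∀ (v : LA Fq A L) (f : L →ₗ[Fq] Fq),
      TensorProduct.lid Fq A (f.rTensor A (v * θ ⊗ₜ[Fq] (1 : A))) =
        TensorProduct.lid Fq A ((f ∘ₗ LinearMap.mulRight Fq θ).rTensor A v) := by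
    intro v f
    induction v using TensorProduct.induction_on with
    | zero => simp
    | add s t hs ht => rw [add_mul, map_add, map_add, hs, ht, map_add, map_add]
    | tmul l b => simp
  have hstable : ∀ w ∈ LinearMap.range W, a * w ∈ LinearMap.range W := by
    rintro _ ⟨f, rfl⟩
    refine ⟨f ∘ₗ LinearMap.mulRight Fq θ, ?_⟩
    change TensorProduct.lid Fq A _ = a * TensorProduct.lid Fq A _
    rw [← hmul, ← hmul']
    rw [mul_sub, sub_eq_zero] at hu
    rw [hu]
  -- All contractions lie in the span of the finitely many second tensor factors of `u`, which is
  -- finite because `Fq` is.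
  have hfin : (LinearMap.range W : Set A).Finite := by
    obtain ⟨S, hS⟩ := TensorProduct.exists_finset u
    have hle : LinearMap.range W ≤ Submodule.span Fq (S.image Prod.snd : Finset A) := by
      rintro _ ⟨f, rfl⟩
      change TensorProduct.lid Fq A (f.rTensor A u) ∈ _
      rw [hS, map_sum, map_sum]
      refine Submodule.sum_mem _ fun p hp => ?_
      simp only [LinearMap.rTensor_tmul, TensorProduct.lid_tmul]
      exact Submodule.smul_mem _ _ (Submodule.subset_span (Finset.mem_image_of_mem _ hp))
    have : Finite (Submodule.span Fq ((S.image Prod.snd : Finset A) : Set A)) :=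
      Module.finite_of_finite Fq
    exact (Set.toFinite (Submodule.span Fq ((S.image Prod.snd : Finset A) : Set A) : Set A)).subset
      hle
  obtain ⟨w, hw, hmax⟩ := Set.exists_max_image _ (fun w => ‖ν w‖) hfin ⟨0, zero_mem _⟩
  have hw0 : w = 0 := by
    by_contra hw0
    have h1 := hmax _ (hstable w hw)
    have h2 : 0 < ‖ν w‖ := norm_pos_iff.2 ((map_ne_zero_iff ν hν).2 hw0)
    simp only [map_mul, norm_mul] at h1
    nlinarith
  obtain ⟨f, hf⟩ := exists_dual_rTensor_ne_zero hu0
  have h1 := hmax _ ⟨f, rfl⟩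
  rw [hw0, map_zero, norm_zero] at h1
  exact hf ((map_eq_zero_iff ν hν).1 (norm_le_zero_iff.1 h1))

end Motives

/-! ### Nilpotency of `J` on a finite-dimensional module -/

/-- By Nakayama the chain `JⁱW` drops strictly in dimension until it reaches zero, so `dim W` steps
suffice. -/
theorem Submodule.pow_smul_top_eq_bot_of_le_radical {L R W : Type*} [Field L]
    [CommRing R] [Algebra L R] [AddCommGroup W] [Module L W] [Module R W] [IsScalarTower L R W]
    [Module.Finite L W]
    (J : Ideal R) (hJ : J ≤ (Module.annihilator R W).radical) {n : ℕ}
    (hn : Module.finrank L W ≤ n) : (J ^ n • ⊤ : Submodule R W) = ⊥ := by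
  have : Module.Finite R W := Module.Finite.of_restrictScalars_finite L R W
  have key : ∀ i, (J ^ i • ⊤ : Submodule R W) ≠ ⊥ →
      Module.finrank L ((J ^ i • ⊤ : Submodule R W).restrictScalars L) + i ≤
        Module.finrank L W := by
    intro i
    induction i with
    | zero =>
      intro _
      exact Submodule.finrank_le _
    | succ i ih =>
      intro hi
      set N : Submodule R W := J ^ i • ⊤ with hN
      have hs : (J ^ (i + 1) • ⊤ : Submodule R W) = J • N := by
        rw [hN, ← mul_smul, pow_succ']
      rw [hs] at hi ⊢
      have hN0 : N ≠ ⊥ := by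
        intro h0
        rw [h0, Submodule.smul_bot] at hi
        exact hi rfl
      have hlt : J • N < N := by
        refine lt_of_le_of_ne Submodule.smul_le_right fun heq => hN0 ?_
        have hfg : N.FG := by
          have : Module.Finite L (N.restrictScalars L) := inferInstance
          have : Module.Finite R N := by
            have : Module.Finite L N := this
            exact Module.Finite.of_restrictScalars_finite L R N
          exact Module.Finite.iff_fg.1 this
        -- If `JN = N`, some `r` kills `N` with `r - 1 ∈ J`. Then `r - 1` acts on `N` as `-1` and
        -- also nilpotently, so `N = 0`.
        obtain ⟨r, hr, hr0⟩ :=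
          Submodule.exists_sub_one_mem_and_smul_eq_zero_of_fg_of_le_smul J N hfg heq.ge
        obtain ⟨p, hp⟩ := hJ hr
        rw [Submodule.eq_bot_iff]
        intro w hw
        have h1 : ∀ q : ℕ, (r - 1) ^ q • w = (-1 : R) ^ q • w := by
          intro q
          induction q with
          | zero => simp
          | succ q ihq => rw [pow_succ, mul_comm, mul_smul, ihq, smul_comm, sub_smul, hr0 w hw,
              pow_succ, mul_smul]; simp
        have h2 := h1 p
        rw [Module.mem_annihilator.1 hp] at h2
        have h3 : (-1 : R) ^ p • ((-1 : R) ^ p • w) = 0 := by rw [← h2, smul_zero]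
        rwa [← mul_smul, ← mul_pow, neg_one_mul, neg_neg, one_pow, one_smul] at h3
      have := Submodule.finrank_lt_finrank_of_lt
        (show (J • N).restrictScalars L < N.restrictScalars L from hlt)
      have := ih hN0
      omega
  by_contra h0
  have h1 := key n h0
  have h2 : Module.finrank L ((J ^ n • ⊤ : Submodule R W).restrictScalars L) = 0 := by omega
  rw [Submodule.finrank_eq_zero] at h2
  exact h0 ((Submodule.restrictScalars_eq_bot_iff ..).1 h2)

namespace AndersonModule

variable {Fq A L : Type*} [Field Fq] [Fintype Fq] [CommRing A] [Algebra Fq A]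
  [Field L] [Algebra Fq L] [IsAlgClosed L] [Algebra A L]
  {d : ℕ} {φ : AndersonModule Fq A L d}

/-! ### The motive -/

instance : IsScalarTower L (LA Fq A L) φ.Motive :=
  ⟨fun l s m => by
    rw [Algebra.smul_def, mul_smul]
    rfl⟩

theorem smul_motive_def (l : L) (m : φ.Motive) : l • m = (l ⊗ₜ[Fq] (1 : A) : LA Fq A L) • m :=
  rfl

theorem smul_dualMotive_def (l : L) (n : φ.DualMotive) :
    l • n = (l ⊗ₜ[Fq] (1 : A) : LA Fq A L) • n :=
  rfl

theorem tau_smul_field (l : L) (m : φ.Motive) :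
    φ.tau (l • m) = (frob Fq L : L ≃+* L) l • φ.tau m := by
  rw [smul_motive_def, tau_smul, twist_tmul]
  rfl

theorem sigma_smul_field (l : L) (n : φ.DualMotive) :
    φ.sigma (l • n) = ((frob Fq L).symm : L ≃+* L) l • φ.sigma n := by
  rw [smul_dualMotive_def, sigma_smul, twist_symm_tmul]
  rfl

theorem tau_one_tmul_smul (a : A) (m : φ.Motive) :
    φ.tau (((1 : L) ⊗ₜ[Fq] a : LA Fq A L) • m) = ((1 : L) ⊗ₜ[Fq] a : LA Fq A L) • φ.tau m := by
  rw [tau_smul, twist_tmul, map_one]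

theorem one_tmul_smul_smul_field (a : A) (l : L) (m : φ.Motive) :
    ((1 : L) ⊗ₜ[Fq] a : LA Fq A L) • l • m = l • ((1 : L) ⊗ₜ[Fq] a : LA Fq A L) • m := by
  rw [smul_motive_def, smul_motive_def, smul_smul, smul_smul, mul_comm]

variable (φ) in
/-- The image of `τ`, an `L ⊗ A`-submodule of the motive. -/
def tauRange : Submodule (LA Fq A L) φ.Motive where
  carrier := Set.range φ.tau
  zero_mem' := ⟨0, map_zero _⟩
  add_mem' := by
    rintro _ _ ⟨m, rfl⟩ ⟨m', rfl⟩
    exact ⟨m + m', map_add _ _ _⟩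
  smul_mem' := by
    rintro s _ ⟨m, rfl⟩
    exact ⟨(twist Fq A L).symm s • m, by rw [tau_smul, AlgEquiv.apply_symm_apply]⟩

namespace AdaptedBases

variable (E : φ.AdaptedBases)

theorem gBasis_repr_smul_g (a : A) (k l : Fin d) (i : ℕ) :
    E.gBasis.repr (((1 : L) ⊗ₜ[Fq] a : LA Fq A L) • E.g k) (l, i) = φ.coeff a i k l := by
  classical
  rw [E.smul_g, map_sum, Finsupp.finsetSum_apply]
  have key : ∀ x : Fin d, E.gBasis.repr ((φ.toAlgHom a k x).act φ.tau (E.g x)) (l, i) =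
      if x = l then (φ.toAlgHom a k x).coeff i else 0 := by
    intro x
    obtain ⟨s, hs, hact⟩ := (φ.toAlgHom a k x).exists_act_eq_sum (M := φ.Motive)
    rw [hact]
    simp only [← E.gBasis_apply, map_sum, map_smul, Finsupp.finsetSum_apply, Finsupp.smul_apply,
      Module.Basis.repr_self, Finsupp.single_apply, smul_eq_mul, mul_ite, mul_one, mul_zero,
      Prod.mk.injEq]
    by_cases hx : x = l
    · by_cases hi : i ∈ s
      · simp [hx, hi]
      · have := hs i hi
        simp_all
    · simp [hx]
  simp [key, coeff]

theorem delta0_add (m m' : φ.Motive) : E.delta0 (m + m') = E.delta0 m + E.delta0 m' := by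
  ext k
  simp [delta0]

theorem delta0_sub (m m' : φ.Motive) : E.delta0 (m - m') = E.delta0 m - E.delta0 m' := by
  ext k
  simp [delta0]

theorem delta0_smul (l : L) (m : φ.Motive) : E.delta0 (l • m) = l • E.delta0 m := by
  ext k
  simp [delta0]

theorem delta0_tau (m : φ.Motive) : E.delta0 (φ.tau m) = 0 :=
  funext fun k => repr_semilinear_zero tau_smul_field E.gBasis_apply m k

theorem delta0_g (k : Fin d) : E.delta0 (E.g k) = Pi.single k 1 := by
  classical
  ext l
  have := E.gBasis_apply k 0
  simp only [Function.iterate_zero, id_eq] at this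
  simp [delta0, ← this, Finsupp.single_apply, Pi.single_apply, eq_comm]

/-- It is enough to look at basis vectors: `gₖ` produces row `k` of `d[a]`, and for `τⁱ gₖ` with `i
> 0` both sides vanish because `a` commutes with `τ`. -/
theorem delta0_one_tmul_smul (a : A) (m : φ.Motive) :
    E.delta0 (((1 : L) ⊗ₜ[Fq] a : LA Fq A L) • m) = Matrix.vecMul (E.delta0 m) (φ.lie a) := by
  induction m using E.gBasis.induction_of_smul with
  | h0 =>
    have h0 : E.delta0 0 = 0 := by
      ext k
      simp [delta0]
    simp [h0]
  | hadd v w hv hw => rw [smul_add, delta0_add, delta0_add, hv, hw, Matrix.add_vecMul]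
  | hs c i =>
    obtain ⟨k, i⟩ := i
    rw [one_tmul_smul_smul_field, delta0_smul, delta0_smul, Matrix.smul_vecMul, E.gBasis_apply]
    congr 1
    cases i with
    | zero =>
      ext l
      simp only [Function.iterate_zero, id_eq]
      rw [delta0_g, Matrix.single_one_vecMul]
      exact E.gBasis_repr_smul_g a k l 0
    | succ i =>
      rw [Function.iterate_succ_apply', ← tau_one_tmul_smul, delta0_tau, delta0_tau,
        Matrix.zero_vecMul]

theorem mem_tauRange_iff (m : φ.Motive) : m ∈ φ.tauRange ↔ E.delta0 m = 0 := by
  constructor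
  · rintro ⟨m, rfl⟩
    exact E.delta0_tau m
  · intro h
    exact exists_semilinear_eq tau_smul_field E.gBasis_apply m fun k => congrFun h k

theorem delta0_sub_pow_smul (a : A) (n : ℕ) (m : φ.Motive) :
    E.delta0 (((1 : L) ⊗ₜ[Fq] a - algebraMap A L a ⊗ₜ[Fq] (1 : A) : LA Fq A L) ^ n • m) =
      Matrix.vecMul (E.delta0 m) ((φ.lie a - Matrix.scalar (Fin d) (algebraMap A L a)) ^ n) := by
  induction n generalizing m with
  | zero => simp
  | succ n ih =>
    rw [pow_succ, mul_smul, ih, sub_smul, delta0_sub, delta0_one_tmul_smul, ← smul_motive_def,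
      delta0_smul, pow_succ', ← Matrix.vecMul_vecMul, Matrix.vecMul_sub]
    congr 2
    ext k
    simp [Matrix.vecMul_diagonal, mul_comm]

theorem exists_sub_pow_smul_mem (E : φ.AdaptedBases) (a : A) : ∃ n, ∀ N ≥ n, ∀ m : φ.Motive,
    ((1 : L) ⊗ₜ[Fq] a - algebraMap A L a ⊗ₜ[Fq] (1 : A) : LA Fq A L) ^ N • m ∈ φ.tauRange := by
  obtain ⟨n, hn⟩ := φ.isNilpotent a
  refine ⟨n, fun N hN m => ?_⟩
  change (φ.lie a - _) ^ n = 0 at hn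
  rw [E.mem_tauRange_iff, delta0_sub_pow_smul, pow_eq_zero_of_le hN hn, Matrix.vecMul_zero]

theorem lie_eq_scalar_of_smul_mem (E : φ.AdaptedBases) (a : A) (θ : L)
    (h : ∀ m : φ.Motive, ((1 : L) ⊗ₜ[Fq] a - θ ⊗ₜ[Fq] (1 : A) : LA Fq A L) • m ∈ φ.tauRange) :
    φ.lie a = Matrix.scalar (Fin d) θ := by
  ext k l
  have := h (E.g k)
  rw [E.mem_tauRange_iff, sub_smul, delta0_sub, delta0_one_tmul_smul, ← smul_motive_def,
    delta0_smul, delta0_g, Matrix.single_one_vecMul, sub_eq_zero] at this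
  rw [show φ.lie a k l = _ from congrFun this l]
  simp [Matrix.diagonal_apply, Pi.single_apply, eq_comm]

end AdaptedBases

/-- `δ₀` embeds `M/τM` in `L^d`, and the generators of `J` act nilpotently there because `d[a] - a`
is nilpotent. This makes `δ₀` well defined modulo `J^d`. -/
theorem AdaptedBases.idealJ_pow_smul_top_le (E : φ.AdaptedBases) :
    (idealJ Fq A L ^ d • ⊤ : Submodule (LA Fq A L) φ.Motive) ≤ φ.tauRange := by
  let W := φ.Motive ⧸ φ.tauRange
  let f : W →ₗ[L] (Fin d → L) :=
    (φ.tauRange.restrictScalars L).liftQ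
      { toFun := E.delta0, map_add' := E.delta0_add, map_smul' := E.delta0_smul }
      (fun m hm => (E.mem_tauRange_iff m).1 hm)
  have hf : Function.Injective f := by
    rw [← LinearMap.ker_eq_bot]
    refine Submodule.ker_liftQ_eq_bot _ _ _ fun m hm => (E.mem_tauRange_iff m).2 hm
  have : Module.Finite L W := Module.Finite.of_injective f hf
  have hW : Module.finrank L W ≤ d := by
    simpa using LinearMap.finrank_le_finrank_of_injective hf
  have hJ : idealJ Fq A L ≤ (Module.annihilator (LA Fq A L) W).radical := by
    refine Ideal.span_le.2 ?_
    rintro _ ⟨a, rfl⟩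
    obtain ⟨n, hn⟩ := E.exists_sub_pow_smul_mem a
    refine ⟨n, Module.mem_annihilator.2 fun w => ?_⟩
    obtain ⟨m, rfl⟩ := Submodule.Quotient.mk_surjective _ w
    rw [← Submodule.Quotient.mk_smul, Submodule.Quotient.mk_eq_zero]
    exact hn n le_rfl m
  have key := Submodule.pow_smul_top_eq_bot_of_le_radical (L := L) _ hJ hW
  have h := congrArg (Submodule.comap φ.tauRange.mkQ) key
  rw [Submodule.comap_bot, Submodule.ker_mkQ] at h
  rw [← h, ← Submodule.map_le_iff_le_comap, Submodule.map_smul'']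
  exact Submodule.smul_mono le_rfl le_top

end AndersonModule

namespace AndersonModule

variable {Fq A L : Type*} [Field Fq] [Fintype Fq] [CommRing A] [Algebra Fq A]
  [Field L] [Algebra Fq L] [IsAlgClosed L] [Algebra A L]
  {d : ℕ} {φ : AndersonModule Fq A L d}

/-! ### The inverse of `τ` on `M_K` -/

theorem tauK_tmul (f : LK Fq A L) (m : φ.Motive) :
    φ.tauK (f ⊗ₜ m) = twistK Fq A L f ⊗ₜ φ.tau m :=
  rfl

theorem tauK_one_tmul (m : φ.Motive) : φ.tauK (1 ⊗ₜ m) = 1 ⊗ₜ φ.tau m := by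
  rw [tauK_tmul, map_one]

theorem tauK_smul (f : LK Fq A L) (u : φ.MotiveK) :
    φ.tauK (f • u) = twistK Fq A L f • φ.tauK u := by
  induction u using TensorProduct.induction_on with
  | zero => simp
  | add u v hu hv => rw [smul_add, map_add, hu, hv, map_add, smul_add]
  | tmul g m => rw [TensorProduct.smul_tmul', tauK_tmul, tauK_tmul, TensorProduct.smul_tmul',
      smul_eq_mul, smul_eq_mul, map_mul]

theorem tauK_smul_base (s : LA Fq A L) (u : φ.MotiveK) :
    φ.tauK (s • u) = twist Fq A L s • φ.tauK u := by
  rw [← algebraMap_smul (LK Fq A L) s, tauK_smul, twistK_algebraMap, algebraMap_smul]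

/-- Write `f ⊗ m = (f/e) ⊗ em`; here `em` lies in `τM`, and the twist is bijective on fractions. -/
theorem tauK_surjective {e : LA Fq A L} (he : e ∈ nonZeroDivisors (LA Fq A L))
    (h : ∀ m : φ.Motive, e • m ∈ φ.tauRange) : Function.Surjective φ.tauK := by
  intro u
  induction u using TensorProduct.induction_on with
  | zero => exact ⟨0, map_zero _⟩
  | add u v hu hv =>
    obtain ⟨u, rfl⟩ := hu
    obtain ⟨v, rfl⟩ := hv
    exact ⟨u + v, map_add _ _ _⟩
  | tmul f m =>
    obtain ⟨m', hm'⟩ := h m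
    obtain ⟨c, hc⟩ := (IsLocalization.map_units (LK Fq A L) ⟨e, he⟩).exists_right_inv
    refine ⟨(twistK Fq A L).symm (f * c) ⊗ₜ m', ?_⟩
    rw [tauK_tmul, RingEquiv.apply_symm_apply, hm', ← TensorProduct.smul_tmul, Algebra.smul_def,
      mul_left_comm, hc, mul_one]

namespace MotivicBases

variable {r : ℕ} (B : φ.MotivicBases r)

theorem repr_tauK (u : φ.MotiveK) :
    ⇑(B.c.repr (φ.tauK u)) = B.Φ.transpose.mulVec fun j => twistK Fq A L (B.c.repr u j) := by
  conv_lhs => rw [← B.c.sum_repr u, map_sum]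
  ext l
  simp [tauK_smul, B.tau_c, Matrix.mulVec, dotProduct, mul_comm, Finsupp.single_apply]

/-- In coordinates `τ` is a twist followed by `Φᵀ`, so surjectivity of `τ` gives `Φᵀ` a right
inverse, which suffices over any commutative ring. -/
theorem isUnit_det (h : Function.Surjective φ.tauK) : IsUnit B.Φ.det := by
  rw [← Matrix.det_transpose]
  have hs : Function.Surjective B.Φ.transpose.mulVec := by
    intro v
    obtain ⟨u, hu⟩ := h (∑ j, v j • B.c j)
    refine ⟨_, (B.repr_tauK u).symm.trans ?_⟩
    rw [hu, B.c.repr_sum_self]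
  obtain ⟨N, hN⟩ := Matrix.mulVec_surjective_iff_exists_right_inverse.1 hs
  exact Matrix.isUnit_det_of_right_inverse hN

theorem repr_tauInv (u : φ.MotiveK) (k : Fin r) :
    B.c.repr (B.tauInv u) k = (twistK Fq A L).symm
      ((B.Φ⁻¹.transpose.mulVec (B.c.repr u)) k) := by
  rw [tauInv, B.c.repr_sum_self]
  simp [Matrix.mulVec, dotProduct]

theorem tauK_tauInv (h : Function.Surjective φ.tauK) (u : φ.MotiveK) :
    φ.tauK (B.tauInv u) = u := by
  refine B.c.ext_elem fun k => ?_
  rw [repr_tauK]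
  simp only [repr_tauInv, RingEquiv.apply_symm_apply]
  change B.Φ.transpose.mulVec (B.Φ⁻¹.transpose.mulVec (B.c.repr u)) k = _
  rw [Matrix.mulVec_mulVec, ← Matrix.transpose_mul, Matrix.nonsing_inv_mul _ (B.isUnit_det h)]
  simp

theorem tauInv_tauK (h : Function.Surjective φ.tauK) (u : φ.MotiveK) :
    B.tauInv (φ.tauK u) = u := by
  refine B.c.ext_elem fun k => ?_
  rw [repr_tauInv, repr_tauK, Matrix.mulVec_mulVec, ← Matrix.transpose_mul,
    Matrix.mul_nonsing_inv _ (B.isUnit_det h)]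
  simp

theorem tauInv_add (h : Function.Surjective φ.tauK) (u v : φ.MotiveK) :
    B.tauInv (u + v) = B.tauInv u + B.tauInv v := by
  conv_lhs => rw [← B.tauK_tauInv h u, ← B.tauK_tauInv h v, ← map_add, B.tauInv_tauK h]

theorem tauInv_smul (h : Function.Surjective φ.tauK) (s : LA Fq A L) (u : φ.MotiveK) :
    B.tauInv (s • u) = (twist Fq A L).symm s • B.tauInv u := by
  conv_lhs => rw [← B.tauK_tauInv h u, ← (twist Fq A L).apply_symm_apply s, ← tauK_smul_base,
    B.tauInv_tauK h]

theorem tauInv_iterate_add (h : Function.Surjective φ.tauK) (n : ℕ) (u v : φ.MotiveK) :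
    B.tauInv^[n] (u + v) = B.tauInv^[n] u + B.tauInv^[n] v := by
  induction n with
  | zero => rfl
  | succ n ih => rw [Function.iterate_succ_apply', ih, tauInv_add B h,
      ← Function.iterate_succ_apply' B.tauInv, ← Function.iterate_succ_apply' B.tauInv]

theorem tauInv_iterate_smul (h : Function.Surjective φ.tauK) (n : ℕ) (s : LA Fq A L)
    (u : φ.MotiveK) :
    B.tauInv^[n] (s • u) = (twist Fq A L).symm^[n] s • B.tauInv^[n] u := by
  induction n with
  | zero => rfl
  | succ n ih => rw [Function.iterate_succ_apply', ih, tauInv_smul B h,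
      ← Function.iterate_succ_apply' B.tauInv, ← Function.iterate_succ_apply' (twist Fq A L).symm]

theorem tauInv_one_tmul_tau (h : Function.Surjective φ.tauK) (m : φ.Motive) :
    B.tauInv (1 ⊗ₜ φ.tau m) = 1 ⊗ₜ m := by
  rw [← tauK_one_tmul, B.tauInv_tauK h]

end MotivicBases

/-! ### Regularity at `Ξ` and the extension of `δ₀` -/

section Regular

variable [IsScalarTower Fq A L]

/-- From `em = τm'` it follows that `e^{(-n-1)} τ⁻ⁿ⁻¹ m = τ⁻ⁿ m'`, so each step adds one factor to
the denominator. -/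
theorem MotivicBases.isRegularAtXi_tauInv_iterate {r : ℕ} (B : φ.MotivicBases r)
    (hsurj : Function.Surjective φ.tauK) {a : A}
    (ha : ∀ n, 0 < n → algebraMap A L a ^ Fintype.card Fq ^ n ≠ algebraMap A L a)
    (h : ∀ m : φ.Motive, ((1 : L) ⊗ₜ[Fq] a - algebraMap A L a ⊗ₜ[Fq] (1 : A) : LA Fq A L) • m ∈
      φ.tauRange) (n : ℕ) (m : φ.Motive) : φ.IsRegularAtXi (B.tauInv^[n] (1 ⊗ₜ m)) := by
  induction n generalizing m with
  | zero => exact ⟨1, one_notMem_idealJ, m, one_smul _ _⟩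
  | succ n ih =>
    obtain ⟨m', hm'⟩ := h m
    set e : LA Fq A L := (1 : L) ⊗ₜ[Fq] a - algebraMap A L a ⊗ₜ[Fq] (1 : A) with he
    have h1 : (twist Fq A L).symm^[n + 1] e • B.tauInv^[n + 1] (1 ⊗ₜ m) =
        B.tauInv^[n] (1 ⊗ₜ m') := by
      rw [← B.tauInv_iterate_smul hsurj, ← TensorProduct.tmul_smul, ← hm',
        Function.iterate_succ_apply, B.tauInv_one_tmul_tau hsurj]
    -- The value at `Ξ` is `θ - θ^{(-n-1)}` with `θ` the image of `a`; if it were zero, raising to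
    -- the power `q^{n+1}` would contradict `ha`.
    have h2 : (twist Fq A L).symm^[n + 1] e ∉ idealJ Fq A L := by
      rw [he, iterate_map_sub, twist_symm_iterate_tmul, twist_symm_iterate_tmul, mem_idealJ_iff,
        map_sub, evalXi_tmul, evalXi_tmul, iterate_map_one, one_mul, map_one, mul_one, sub_eq_zero]
      intro h3
      refine ha (n + 1) n.succ_pos ?_
      conv_lhs => rw [h3]
      exact iterate_frob_symm_pow _ _
    obtain ⟨s, hs, m'', hm''⟩ := ih m'
    exact ⟨s * _, mul_notMem_idealJ hs h2, m'', by rw [mul_smul, h1, hm'']⟩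

theorem one_tmul_injective [Module.Flat (LA Fq A L) φ.Motive] :
    Function.Injective fun m : φ.Motive => (1 ⊗ₜ m : φ.MotiveK) := by
  have h := Module.Flat.rTensor_preserves_injective_linearMap (M := φ.Motive)
    (Algebra.linearMap (LA Fq A L) (LK Fq A L)) (IsFractionRing.injective _ _)
  intro m m' hm
  have := @h (1 ⊗ₜ m) (1 ⊗ₜ m') (by simpa using hm)
  simpa using congrArg (TensorProduct.lid _ _) this

theorem isCongrModJ_one_tmul (m : φ.Motive) : φ.IsCongrModJ (1 ⊗ₜ m) m :=
  ⟨1, one_notMem_idealJ, 0, zero_mem _, by simp⟩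

theorem IsRegularAtXi.exists_isCongrModJ {u : φ.MotiveK} (hu : φ.IsRegularAtXi u) :
    ∃ m, φ.IsCongrModJ u m := by
  obtain ⟨s, hs, m, hm⟩ := hu
  obtain ⟨t, ht⟩ := exists_one_sub_mul_mem_pow hs d
  refine ⟨t • m, s, hs, (1 - s * t) • m, Submodule.smul_mem_smul ht trivial, ?_⟩
  rw [smul_sub, hm, ← TensorProduct.tmul_smul, ← TensorProduct.tmul_sub, sub_smul, one_smul,
    mul_smul]

theorem IsCongrModJ.add {u u' : φ.MotiveK} {m m' : φ.Motive} (h : φ.IsCongrModJ u m)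
    (h' : φ.IsCongrModJ u' m') : φ.IsCongrModJ (u + u') (m + m') := by
  obtain ⟨s, hs, n, hn, e⟩ := h
  obtain ⟨s', hs', n', hn', e'⟩ := h'
  refine ⟨s * s', mul_notMem_idealJ hs hs', s' • n + s • n',
    add_mem (Submodule.smul_mem _ _ hn) (Submodule.smul_mem _ _ hn'), ?_⟩
  rw [TensorProduct.tmul_add, add_sub_add_comm, smul_add, mul_smul s s' (u' - _), e',
    mul_comm, mul_smul, e, TensorProduct.tmul_add, TensorProduct.tmul_smul,
    TensorProduct.tmul_smul]

theorem IsCongrModJ.smul {u : φ.MotiveK} {m : φ.Motive} (t : LA Fq A L)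
    (h : φ.IsCongrModJ u m) : φ.IsCongrModJ (t • u) (t • m) := by
  obtain ⟨s, hs, n, hn, e⟩ := h
  refine ⟨s, hs, t • n, Submodule.smul_mem _ _ hn, ?_⟩
  have h1 : t • u - 1 ⊗ₜ (t • m) = t • (u - 1 ⊗ₜ m) := by
    rw [TensorProduct.tmul_smul]
    exact (smul_sub t u _).symm
  rw [h1, smul_comm, e, TensorProduct.tmul_smul]

/-- Flatness moves the comparison from `M_K` back to `M`, where some `s` nonvanishing at `Ξ` takes
`m - m'` into `J^d M`; such an `s` is invertible modulo `J^d`. -/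
theorem IsCongrModJ.sub_mem_pow_smul [Module.Flat (LA Fq A L) φ.Motive]
    {u : φ.MotiveK} {m m' : φ.Motive}
    (h : φ.IsCongrModJ u m) (h' : φ.IsCongrModJ u m') :
    m - m' ∈ (idealJ Fq A L ^ d • ⊤ : Submodule (LA Fq A L) φ.Motive) := by
  have h0 : φ.IsCongrModJ (u + (-1 : LA Fq A L) • u) (m + (-1 : LA Fq A L) • m') :=
    h.add (h'.smul _)
  have hu : (-1 : LA Fq A L) • u = -u := neg_one_smul _ u
  rw [neg_one_smul, hu, add_neg_cancel, ← sub_eq_add_neg] at h0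
  obtain ⟨s, hs, n, hn, e⟩ := h0
  rw [zero_sub, ← TensorProduct.tmul_neg, ← TensorProduct.tmul_smul] at e
  have e' : s • -(m - m') = n := one_tmul_injective e
  obtain ⟨t, ht⟩ := exists_one_sub_mul_mem_pow hs d
  have h1 : m - m' = (1 - s * t) • (m - m') - t • n := by
    rw [← e', smul_neg, smul_neg, sub_neg_eq_add, sub_smul, one_smul, mul_comm s t, mul_smul,
      sub_add_cancel]
  rw [h1]
  exact sub_mem (Submodule.smul_mem_smul ht trivial) (Submodule.smul_mem _ _ hn)

namespace AdaptedBases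

variable (E : φ.AdaptedBases) [Module.Flat (LA Fq A L) φ.Motive]

/-- Frees `delta0K` from the representative picked by `choose`. -/
theorem delta0K_eq {u : φ.MotiveK} {m : φ.Motive} (h : φ.IsCongrModJ u m) :
    E.delta0K u = E.delta0 m := by
  have hu : ∃ m, φ.IsCongrModJ u m := ⟨m, h⟩
  rw [delta0K, dif_pos hu, ← sub_eq_zero, ← delta0_sub, ← mem_tauRange_iff]
  exact E.idealJ_pow_smul_top_le (hu.choose_spec.sub_mem_pow_smul h)

theorem delta0K_add {u v : φ.MotiveK} (hu : φ.IsRegularAtXi u) (hv : φ.IsRegularAtXi v) :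
    E.delta0K (u + v) = E.delta0K u + E.delta0K v := by
  obtain ⟨m, hm⟩ := hu.exists_isCongrModJ
  obtain ⟨n, hn⟩ := hv.exists_isCongrModJ
  rw [E.delta0K_eq hm, E.delta0K_eq hn, E.delta0K_eq (hm.add hn), delta0_add]

theorem delta0K_tmul_one_smul (l : L) {u : φ.MotiveK} (hu : φ.IsRegularAtXi u) :
    E.delta0K ((l ⊗ₜ[Fq] (1 : A) : LA Fq A L) • u) = l • E.delta0K u := by
  obtain ⟨m, hm⟩ := hu.exists_isCongrModJ
  rw [E.delta0K_eq hm, E.delta0K_eq (hm.smul _), ← smul_motive_def, delta0_smul]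

theorem delta0K_one_tmul_smul (a : A) {u : φ.MotiveK} (hu : φ.IsRegularAtXi u) :
    E.delta0K (((1 : L) ⊗ₜ[Fq] a : LA Fq A L) • u) = Matrix.vecMul (E.delta0K u) (φ.lie a) := by
  obtain ⟨m, hm⟩ := hu.exists_isCongrModJ
  rw [E.delta0K_eq hm, E.delta0K_eq (hm.smul _), delta0_one_tmul_smul]

theorem delta0K_one_tmul (m : φ.Motive) : E.delta0K (1 ⊗ₜ m) = E.delta0 m :=
  E.delta0K_eq (isCongrModJ_one_tmul m)

end AdaptedBases

end Regular

end AndersonModule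

/-! ### The vectors `δ₀(τ⁻ⁿ m)` and the functional equation -/

section Motives

variable {Fq L : Type*} [Field Fq] [Fintype Fq] [Field L] [Algebra Fq L] [IsAlgClosed L]

variable (Fq L) in
/-- The ring homomorphism `x ↦ x ^ q ^ n`. -/
def frobPow (n : ℕ) : L →+* L := (frob Fq L : L →+* L) ^ n

theorem frobPow_apply (n : ℕ) (x : L) : frobPow Fq L n x = x ^ Fintype.card Fq ^ n := by
  rw [frobPow, RingHom.coe_pow]
  exact iterate_frob_apply n x

end Motives

namespace AndersonModule

variable {Fq A L : Type*} [Field Fq] [Fintype Fq] [CommRing A] [Algebra Fq A]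
  [Field L] [Algebra Fq L] [IsAlgClosed L] [Algebra A L]
  {d r : ℕ} {φ : AndersonModule Fq A L d}

theorem exists_coeff_eq_zero (a : A) : ∃ s, ∀ p, s ≤ p → φ.coeff a p = 0 := by
  have h : ∀ k l, ∀ᶠ p in Filter.atTop, φ.coeff a p k l = 0 := by
    intro k l
    obtain ⟨s, hs, -⟩ := (φ.toAlgHom a k l).exists_act_eq_sum (M := φ.Motive)
    filter_upwards [Filter.eventually_gt_atTop (s.sup id)] with p hp
    exact hs p fun hps => (Finset.le_sup (f := id) hps).not_gt hp
  obtain ⟨s, hs⟩ := Filter.eventually_atTop.1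
    (Filter.eventually_all.2 fun k => Filter.eventually_all.2 (h k))
  exact ⟨s, fun p hp => Matrix.ext (hs p hp)⟩

namespace AdaptedBases

/-- The vector `δ₀(τ⁻ⁿ m)`. -/
def deltaIter (E : φ.AdaptedBases) (B : φ.MotivicBases r) (n : ℕ) (m : φ.Motive) : Fin d → L :=
  E.delta0K (B.tauInv^[n] (1 ⊗ₜ m))

/-- The coefficients of the exponential series: row `k` of the `n`-th one is
`δ₀(τ⁻ⁿ gₖ)^{(n)}`. -/
def expCoeff (E : φ.AdaptedBases) (B : φ.MotivicBases r) (n : ℕ) : Matrix (Fin d) (Fin d) L :=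
  Matrix.of fun k l => E.deltaIter B n (E.g k) l ^ Fintype.card Fq ^ n

section DeltaIter

variable [IsScalarTower Fq A L] [Module.Flat (LA Fq A L) φ.Motive]
  (E : φ.AdaptedBases) (B : φ.MotivicBases r)

theorem deltaIter_zero (m : φ.Motive) : E.deltaIter B 0 m = E.delta0 m :=
  E.delta0K_one_tmul m

theorem deltaIter_add (hsurj : Function.Surjective φ.tauK)
    (hreg : ∀ n m, φ.IsRegularAtXi (B.tauInv^[n] (1 ⊗ₜ m))) (n : ℕ) (m m' : φ.Motive) :
    E.deltaIter B n (m + m') = E.deltaIter B n m + E.deltaIter B n m' := by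
  rw [deltaIter, TensorProduct.tmul_add, B.tauInv_iterate_add hsurj,
    E.delta0K_add (hreg n m) (hreg n m')]
  rfl

theorem deltaIter_smul (hsurj : Function.Surjective φ.tauK)
    (hreg : ∀ n m, φ.IsRegularAtXi (B.tauInv^[n] (1 ⊗ₜ m))) (n : ℕ) (l : L) (m : φ.Motive) :
    E.deltaIter B n (l • m) = (frob Fq L).symm^[n] l • E.deltaIter B n m := by
  rw [deltaIter, smul_motive_def, TensorProduct.tmul_smul, B.tauInv_iterate_smul hsurj,
    twist_symm_iterate_tmul, E.delta0K_tmul_one_smul _ (hreg n m)]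
  rfl

theorem deltaIter_map_zero (hsurj : Function.Surjective φ.tauK)
    (hreg : ∀ n m, φ.IsRegularAtXi (B.tauInv^[n] (1 ⊗ₜ m))) (n : ℕ) :
    E.deltaIter B n 0 = 0 := by
  simpa using E.deltaIter_add B hsurj hreg n 0 0

theorem deltaIter_one_tmul_smul (hsurj : Function.Surjective φ.tauK)
    (hreg : ∀ n m, φ.IsRegularAtXi (B.tauInv^[n] (1 ⊗ₜ m))) (n : ℕ) (a : A) (m : φ.Motive) :
    E.deltaIter B n (((1 : L) ⊗ₜ[Fq] a : LA Fq A L) • m) =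
      Matrix.vecMul (E.deltaIter B n m) (φ.lie a) := by
  rw [deltaIter, TensorProduct.tmul_smul, B.tauInv_iterate_smul hsurj,
    twist_symm_iterate_tmul, iterate_map_one, E.delta0K_one_tmul_smul _ (hreg n m)]
  rfl

theorem deltaIter_tau_iterate (hsurj : Function.Surjective φ.tauK) {n p : ℕ} (h : p ≤ n)
    (m : φ.Motive) : E.deltaIter B n (φ.tau^[p] m) = E.deltaIter B (n - p) m := by
  induction p generalizing n with
  | zero => rfl
  | succ p ih =>
    obtain ⟨n, rfl⟩ : ∃ n', n = n' + 1 := ⟨n - 1, by omega⟩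
    rw [Function.iterate_succ_apply', deltaIter, Function.iterate_succ_apply,
      B.tauInv_one_tmul_tau hsurj]
    have := ih (n := n) (by omega)
    rw [deltaIter] at this
    rw [this]
    congr 1
    omega

theorem deltaIter_tau_iterate_of_lt (hsurj : Function.Surjective φ.tauK) {n p : ℕ} (h : n < p)
    (m : φ.Motive) : E.deltaIter B n (φ.tau^[p] m) = 0 := by
  obtain ⟨c, rfl⟩ : ∃ c, p = n + (c + 1) := ⟨p - n - 1, by omega⟩
  rw [Function.iterate_add_apply, E.deltaIter_tau_iterate B hsurj le_rfl, Nat.sub_self,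
    deltaIter_zero, Function.iterate_succ_apply', delta0_tau]

/-- Expand `m` in the `τᵖ gₖ`. The terms with `p > n` disappear because `τ⁻ⁿ τᵖ gₖ` still lies in
`τM`. -/
theorem deltaIter_eq_sum (hsurj : Function.Surjective φ.tauK)
    (hreg : ∀ n m, φ.IsRegularAtXi (B.tauInv^[n] (1 ⊗ₜ m))) (n : ℕ) (m : φ.Motive) :
    E.deltaIter B n m = ∑ p ∈ Finset.range (n + 1), ∑ k,
      (frob Fq L).symm^[n] (E.gBasis.repr m (k, p)) • E.deltaIter B (n - p) (E.g k) := by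
  classical
  induction m using E.gBasis.induction_of_smul with
  | h0 => simp [E.deltaIter_map_zero B hsurj hreg, iterate_map_zero]
  | hadd v w hv hw =>
    rw [E.deltaIter_add B hsurj hreg, hv, hw]
    simp [iterate_map_add, add_smul, Finset.sum_add_distrib]
  | hs c i =>
    obtain ⟨k, i⟩ := i
    have hite : ∀ (P : Prop) [Decidable P] (x : L), (frob Fq L).symm^[n] (if P then x else 0) =
        if P then (frob Fq L).symm^[n] x else 0 := by
      intro P _ x
      split_ifs
      · rfl
      · exact iterate_map_zero _ _
    rw [E.deltaIter_smul B hsurj hreg, E.gBasis_apply]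
    simp only [← E.gBasis_apply, map_smul, Module.Basis.repr_self, Finsupp.smul_single,
      smul_eq_mul, mul_one, Finsupp.single_apply, Prod.mk.injEq, hite, ite_smul, zero_smul,
      ite_and, Finset.sum_ite_eq, Finset.mem_univ, if_true, Finset.mem_range]
    rw [E.gBasis_apply]
    by_cases h : i ≤ n
    · simp [E.deltaIter_tau_iterate B hsurj h, Nat.lt_succ_of_le h]
    · rw [E.deltaIter_tau_iterate_of_lt B hsurj (not_le.1 h)]
      simp [h]

theorem expCoeff_zero : E.expCoeff B 0 = 1 := by
  ext k l
  rw [expCoeff, Matrix.of_apply, deltaIter_zero, delta0_g]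
  simp [Matrix.one_apply, Pi.single_apply, eq_comm]

/-- Evaluate `δ₀(τ⁻ⁿ(a gₖ))` in two ways, by `A`-linearity and by expanding `a gₖ`, then raise to
the power `q^n` to remove all inverse twists. -/
theorem expCoeff_functional (hsurj : Function.Surjective φ.tauK)
    (hreg : ∀ n m, φ.IsRegularAtXi (B.tauInv^[n] (1 ⊗ₜ m))) (a : A) (n : ℕ) :
    E.expCoeff B n * (φ.lie a).map (fun x => x ^ Fintype.card Fq ^ n) =
      ∑ p ∈ Finset.HasAntidiagonal.antidiagonal n, φ.coeff a p.1 *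
        (E.expCoeff B p.2).map (fun x => x ^ Fintype.card Fq ^ p.1) := by
  ext k l
  have h1 := congrArg (frobPow Fq L n)
    (congrFun (E.deltaIter_one_tmul_smul B hsurj hreg n a (E.g k)) l)
  rw [E.deltaIter_eq_sum B hsurj hreg] at h1
  simp only [gBasis_repr_smul_g, Matrix.vecMul, dotProduct, map_sum, map_mul, frobPow_apply,
    Finset.sum_apply, Pi.smul_apply, smul_eq_mul, iterate_frob_symm_pow] at h1
  rw [Matrix.sum_apply, Finset.Nat.sum_antidiagonal_eq_sum_range_succ_mk]
  simp only [Matrix.mul_apply, Matrix.map_apply, expCoeff, Matrix.of_apply]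
  rw [← h1]
  refine Finset.sum_congr rfl fun p hp => Finset.sum_congr rfl fun j _ => ?_
  rw [← pow_mul, ← pow_add, Nat.sub_add_cancel (Nat.lt_succ_iff.1 (Finset.mem_range.1 hp))]

/-! ### The terms of the pairing -/

theorem coord_sigma_iterate (n : φ.DualMotive) (i : ℕ) (k : Fin d) (j : ℕ) :
    E.coord (φ.sigma^[i] n) k j =
      if i ≤ j then (frob Fq L).symm^[i] (E.coord n k (j - i)) else 0 :=
  repr_iterate_semilinear sigma_smul_field E.hBasis_apply i n k j

theorem coord_term (x : LATau Fq A L) (y : LASigma Fq A L) (z : Fin d → L) (i : ℕ) (k : Fin d)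
    (j : ℕ) : E.coord (E.term B x y z i) k j =
      ∑ k', (E.deltaIter B i (x.act φ.tau (E.g k')) ⬝ᵥ z) *
        if i ≤ j then (frob Fq L).symm^[i] (E.coord (y.act φ.sigma (E.h k')) k (j - i)) else 0 := by
  simp only [← coord_sigma_iterate]
  simp [coord, term, deltaIter]

theorem support_coord_term_subset (x : LATau Fq A L) (y : LASigma Fq A L) (z : Fin d → L)
    (k : Fin d) (j : ℕ) :
    (Function.support fun i => E.coord (E.term B x y z i) k j) ⊆ Finset.range (j + 1) := by
  intro i hi
  by_contra h
  apply hi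
  have h' : ¬ i ≤ j := by simpa [Nat.lt_succ_iff] using h
  simp [coord_term, h']

/-- The `i`-th term lies in the span of the `σⁱ hₖ`, so only `i = j` contributes. -/
theorem series_one_one (z : Fin d → L) (k : Fin d) (j : ℕ) :
    E.series B 1 1 z k j = E.deltaIter B j (E.g k) ⬝ᵥ z := by
  classical
  have h : ∀ i, E.coord (E.term B 1 1 z i) k j =
      if i = j then E.deltaIter B j (E.g k) ⬝ᵥ z else 0 := by
    intro i
    simp only [term, SkewPoly.one_act, coord, ← E.hBasis_apply, map_sum, map_smul,
      Finsupp.finsetSum_apply, Finsupp.smul_apply, Module.Basis.repr_self, Finsupp.single_apply,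
      Prod.mk.injEq]
    by_cases hij : i = j <;> simp [hij, deltaIter]
  rw [series]
  simp only [h]
  exact finsum_eq_single _ j (fun i hi => by simp [hi]) |>.trans (by simp)

end DeltaIter

end AdaptedBases

end AndersonModule

/-! ### Convergence -/

/-- Gaining a factor `β` every `s` steps amounts to geometric decay of ratio `ρ = β^{1/s}`. -/
theorem tendsto_zero_of_le_mul_preceding {w : ℕ → ℝ} (hw : ∀ n, 0 ≤ w n) {β : ℝ} (hβ0 : 0 < β)
    (hβ1 : β < 1) {s n₀ : ℕ} (hs : s ≠ 0) (hsn : s ≤ n₀)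
    (h : ∀ n ≥ n₀, ∀ M, 0 ≤ M → (∀ p < s, w (n - (p + 1)) ≤ M) → w n ≤ β * M) :
    Filter.Tendsto w Filter.atTop (𝓝 0) := by
  set ρ : ℝ := β ^ ((s : ℝ)⁻¹)
  have hρ0 : 0 < ρ := Real.rpow_pos_of_pos hβ0 _
  have hρ1 : ρ < 1 := Real.rpow_lt_one hβ0.le hβ1 (by positivity)
  have hρs : ρ ^ s = β := Real.rpow_inv_natCast_pow hβ0.le hs
  -- `K` is large enough for `w n ≤ K ρⁿ` to hold at all `n < n₀`, which starts the induction.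
  set K := ∑ n ∈ Finset.range n₀, w n / ρ ^ n with hK
  have hpos : ∀ n, 0 ≤ w n / ρ ^ n := fun n => div_nonneg (hw n) (by positivity)
  have hK0 : 0 ≤ K := Finset.sum_nonneg fun n _ => hpos n
  have key : ∀ n, w n ≤ K * ρ ^ n := by
    intro n
    induction n using Nat.strong_induction_on with
    | _ n ih =>
      by_cases hn : n < n₀
      · rw [← div_le_iff₀ (by positivity)]
        exact Finset.single_le_sum (fun n _ => hpos n) (Finset.mem_range.2 hn)
      · push Not at hn
        have h1 := h n hn (K * ρ ^ (n - s)) (by positivity) fun p hp =>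
          (ih _ (by omega)).trans (mul_le_mul_of_nonneg_left
            (pow_le_pow_of_le_one hρ0.le hρ1.le (by omega)) hK0)
        refine h1.trans (le_of_eq ?_)
        rw [← hρs, mul_left_comm, ← pow_add, Nat.add_sub_cancel' (hsn.trans hn)]
  refine squeeze_zero hw key ?_
  simpa using (tendsto_pow_atTop_nhds_zero_of_lt_one hρ0.le hρ1).const_mul K

theorem Filter.Tendsto.pow_pow_zero {C : Type*} [NormedField C] {x : ℕ → C}
    (hx : Filter.Tendsto x Filter.atTop (𝓝 0)) {q : ℕ} (hq : 0 < q) :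
    Filter.Tendsto (fun n => x n ^ q ^ n) Filter.atTop (𝓝 0) := by
  rw [tendsto_zero_iff_norm_tendsto_zero] at hx ⊢
  refine squeeze_zero' (Filter.Eventually.of_forall fun n => norm_nonneg _) ?_ hx
  filter_upwards [hx.eventually (gt_mem_nhds one_pos)] with n hn
  rw [norm_pow]
  exact pow_le_of_le_one (norm_nonneg _) hn.le (pow_pos hq n).ne'

section Frobenius

variable {Fq L C : Type*} [Field Fq] [Fintype Fq] [Field L] [Algebra Fq L] [IsAlgClosed L]
  [NormedField C] [Algebra L C]

/-- The `q^n`-th root of `‖x‖` is at most `b` once `b^{q^n}` exceeds `‖x‖`. -/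
theorem eventually_norm_frob_symm_iterate_le (x : L) {b : ℝ} (hb : 1 < b) :
    ∀ᶠ n in Filter.atTop, ‖algebraMap L C ((frob Fq L).symm^[n] x)‖ ≤ b := by
  have hq : 1 < Fintype.card Fq := Fintype.one_lt_card
  have h1 : Filter.Tendsto (fun n : ℕ => b ^ Fintype.card Fq ^ n) Filter.atTop Filter.atTop :=
    (tendsto_pow_atTop_atTop_of_one_lt hb).comp (tendsto_pow_atTop_atTop_of_one_lt hq)
  filter_upwards [h1.eventually_ge_atTop ‖algebraMap L C x‖] with n hn
  by_contra! hlt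
  have h2 : b ^ Fintype.card Fq ^ n <
      ‖algebraMap L C ((frob Fq L).symm^[n] x)‖ ^ Fintype.card Fq ^ n :=
    pow_lt_pow_left₀ hlt (by positivity) (by positivity)
  rw [← norm_pow, ← map_pow, iterate_frob_symm_pow] at h2
  exact h2.not_ge hn

theorem isBoundedUnder_norm_frob_symm_iterate (x : L) :
    Filter.IsBoundedUnder (· ≤ ·) Filter.atTop
      (norm ∘ fun n => algebraMap L C ((frob Fq L).symm^[n] x)) :=
  ⟨2, eventually_norm_frob_symm_iterate_le x one_lt_two⟩

end Frobenius

/-! ### Decay of `δ₀(τ⁻ⁿ m)` and its consequences -/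

namespace AndersonModule.AdaptedBases

variable {Fq A L C : Type*} [Field Fq] [Fintype Fq] [CommRing A] [Algebra Fq A]
  [Field L] [Algebra Fq L] [IsAlgClosed L] [Algebra A L] [NormedField C] [Algebra L C]
  {d r : ℕ} {φ : AndersonModule Fq A L d}
  [IsScalarTower Fq A L] [Module.Flat (LA Fq A L) φ.Motive]
  (E : φ.AdaptedBases) (B : φ.MotivicBases r)

/-- The recursion for `Dₙ` with its `p = 0` term `θ^{(-n)} Dₙ` moved to the left. -/
theorem sub_mul_deltaIter_g (hsurj : Function.Surjective φ.tauK)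
    (hreg : ∀ n m, φ.IsRegularAtXi (B.tauInv^[n] (1 ⊗ₜ m))) {a : A} {θ : L}
    (ha : φ.lie a = Matrix.scalar (Fin d) θ) (n : ℕ) (k l : Fin d) :
    (θ - (frob Fq L).symm^[n] θ) * E.deltaIter B n (E.g k) l =
      ∑ p ∈ Finset.range n, ∑ j, (frob Fq L).symm^[n] (φ.coeff a (p + 1) k j) *
        E.deltaIter B (n - (p + 1)) (E.g j) l := by
  classical
  have h1 := congrFun (E.deltaIter_one_tmul_smul B hsurj hreg n a (E.g k)) l
  rw [E.deltaIter_eq_sum B hsurj hreg, Finset.sum_range_succ'] at h1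
  have h0 : ∀ j, φ.coeff a 0 k j = if k = j then θ else 0 := by
    intro j
    change φ.lie a k j = _
    rw [ha]
    simp [Matrix.diagonal_apply]
  have hite : ∀ (P : Prop) [Decidable P] (x : L), (frob Fq L).symm^[n] (if P then x else 0) =
      if P then (frob Fq L).symm^[n] x else 0 := by
    intro P _ x
    split_ifs
    · rfl
    · exact iterate_map_zero _ _
  simp only [gBasis_repr_smul_g, h0, hite, ha] at h1
  simp [Finset.sum_apply, Matrix.vecMul_diagonal] at h1
  linear_combination -h1

theorem tendsto_deltaIter_g [IsUltrametricDist C] (hsurj : Function.Surjective φ.tauK)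
    (hreg : ∀ n m, φ.IsRegularAtXi (B.tauInv^[n] (1 ⊗ₜ m))) {a : A} {θ : L}
    (ha : φ.lie a = Matrix.scalar (Fin d) θ) (hθ : 1 < ‖algebraMap L C θ‖) (k l : Fin d) :
    Filter.Tendsto (fun n => algebraMap L C (E.deltaIter B n (E.g k) l)) Filter.atTop (𝓝 0) := by
  let v : ℕ → Fin d → Fin d → C := fun n k l => algebraMap L C (E.deltaIter B n (E.g k) l)
  have hv : ∀ n k l, ‖v n k l‖ ≤ ‖v n‖ := fun n k l =>
    (norm_le_pi_norm (v n k) l).trans (norm_le_pi_norm (v n) k)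
  suffices h : Filter.Tendsto (fun n => ‖v n‖) Filter.atTop (𝓝 0) from
    tendsto_zero_iff_norm_tendsto_zero.2 (squeeze_zero (fun n => norm_nonneg _)
      (fun n => hv n k l) h)
  obtain ⟨b, hb1, hbθ⟩ := exists_between hθ
  obtain ⟨s, hs⟩ := φ.exists_coeff_eq_zero a
  have hev : ∀ᶠ n in Filter.atTop, ∀ p ∈ Finset.range (s + 2), ∀ k j,
      ‖algebraMap L C ((frob Fq L).symm^[n] (φ.coeff a p k j))‖ ≤ b :=
    (Filter.eventually_all_finset _).2 fun p _ => Filter.eventually_all.2 fun k =>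
      Filter.eventually_all.2 fun j => eventually_norm_frob_symm_iterate_le _ hb1
  obtain ⟨n₀, hn₀⟩ := Filter.eventually_atTop.1
    (hev.and (eventually_norm_frob_symm_iterate_le (Fq := Fq) (C := C) θ hb1))
  have hb0 : 0 < b := one_pos.trans hb1
  have hθ0 : 0 < ‖algebraMap L C θ‖ := hb0.trans hbθ
  -- The window is `s + 1` rather than `s` so as to be nonempty; starting at `n₀ + (s + 1)` keeps
  -- every index `n - (p + 1)` free of truncation.
  refine tendsto_zero_of_le_mul_preceding (fun n => norm_nonneg _) (div_pos hb0 hθ0)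
    ((div_lt_one hθ0).2 hbθ) (s := s + 1) (n₀ := n₀ + (s + 1)) (by omega) (by omega) ?_
  intro n hn M hM hp
  have hbM : 0 ≤ b / ‖algebraMap L C θ‖ * M := by positivity
  refine (pi_norm_le_iff_of_nonneg hbM).2 fun k => (pi_norm_le_iff_of_nonneg hbM).2 fun l => ?_
  obtain ⟨h1, h2⟩ := hn₀ n (by omega)
  have h3 := congrArg (fun x => ‖algebraMap L C x‖) (E.sub_mul_deltaIter_g B hsurj hreg ha n k l)
  simp only [map_mul, map_sub, map_sum, norm_mul] at h3
  -- The root `θ^{(-n)}` has norm at most `b < ‖θ‖`, so the ultrametric inequality is an equality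
  -- here.
  have h4 : ‖algebraMap L C θ - algebraMap L C ((frob Fq L).symm^[n] θ)‖ =
      ‖algebraMap L C θ‖ := by
    rw [sub_eq_add_neg, IsUltrametricDist.norm_add_eq_max_of_norm_ne_norm, norm_neg, max_eq_left]
    · exact h2.trans hbθ.le
    · rw [norm_neg]
      exact (h2.trans_lt hbθ).ne'
  rw [h4] at h3
  rw [div_mul_eq_mul_div, le_div_iff₀' hθ0, h3]
  have hbM' : 0 ≤ b * M := by positivity
  refine IsUltrametricDist.norm_sum_le_of_forall_le_of_nonneg hbM' fun p _ =>
    IsUltrametricDist.norm_sum_le_of_forall_le_of_nonneg hbM' fun j _ => ?_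
  rw [norm_mul]
  by_cases hps : p < s + 1
  · exact mul_le_mul (h1 (p + 1) (Finset.mem_range.2 (by omega)) k j)
      ((hv _ j l).trans (hp p hps)) (norm_nonneg _) hb0.le
  · rw [hs (p + 1) (by omega), Matrix.zero_apply, iterate_map_zero, map_zero, norm_zero, zero_mul]
    exact hbM'

theorem tendsto_deltaIter [IsUltrametricDist C] (hsurj : Function.Surjective φ.tauK)
    (hreg : ∀ n m, φ.IsRegularAtXi (B.tauInv^[n] (1 ⊗ₜ m))) {a : A} {θ : L}
    (ha : φ.lie a = Matrix.scalar (Fin d) θ) (hθ : 1 < ‖algebraMap L C θ‖) (m : φ.Motive)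
    (l : Fin d) :
    Filter.Tendsto (fun n => algebraMap L C (E.deltaIter B n m l)) Filter.atTop (𝓝 0) := by
  induction m using E.gBasis.induction_of_smul with
  | h0 => simp [E.deltaIter_map_zero B hsurj hreg]
  | hadd v w hv hw => simpa [E.deltaIter_add B hsurj hreg] using hv.add hw
  | hs c i =>
    obtain ⟨k, i⟩ := i
    simp only [E.deltaIter_smul B hsurj hreg, Pi.smul_apply, smul_eq_mul, map_mul, E.gBasis_apply]
    refine Filter.isBoundedUnder_le_mul_tendsto_zero (isBoundedUnder_norm_frob_symm_iterate c) ?_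
    refine ((E.tendsto_deltaIter_g B hsurj hreg ha hθ k l).comp
      (Filter.tendsto_sub_atTop_nat i)).congr' ?_
    filter_upwards [Filter.eventually_ge_atTop i] with n hn
    rw [E.deltaIter_tau_iterate B hsurj hn]
    rfl

theorem exists_coord_eq_zero (n : φ.DualMotive) (k : Fin d) :
    ∃ N, ∀ p ≥ N, E.coord n k p = 0 := by
  refine ⟨(E.hBasis.repr n).support.sup Prod.snd + 1, fun p hp => ?_⟩
  by_contra h
  have := Finset.le_sup (f := Prod.snd) (Finsupp.mem_support_iff.2 h)
  simp only at this
  omega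

/-- Coefficient `j` is a convolution over `i ≤ j`. Since `y hₖ` has finitely many coefficients, only
`i` close to `j` matter, and there `δ₀(τ⁻ⁱ(x gₖ))` is small while the twisted coefficients of `y hₖ`
stay bounded. -/
theorem tendsto_series [IsUltrametricDist C] (hsurj : Function.Surjective φ.tauK)
    (hreg : ∀ n m, φ.IsRegularAtXi (B.tauInv^[n] (1 ⊗ₜ m))) {a : A} {θ : L}
    (ha : φ.lie a = Matrix.scalar (Fin d) θ) (hθ : 1 < ‖algebraMap L C θ‖)
    (x : LATau Fq A L) (y : LASigma Fq A L) (z : Fin d → L) (k : Fin d) :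
    Filter.Tendsto (fun j => algebraMap L C (E.series B x y z k j)) Filter.atTop (𝓝 0) := by
  rw [NormedAddGroup.tendsto_nhds_zero]
  intro ε hε
  have hD : ∀ k', Filter.Tendsto
      (fun n => algebraMap L C (E.deltaIter B n (x.act φ.tau (E.g k')) ⬝ᵥ z))
      Filter.atTop (𝓝 0) := by
    intro k'
    have : Filter.Tendsto (fun n => ∑ l, algebraMap L C
        (E.deltaIter B n (x.act φ.tau (E.g k')) l) * algebraMap L C (z l))
        Filter.atTop (𝓝 (∑ _l : Fin d, 0)) := by
      refine tendsto_finsetSum _ fun l _ => ?_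
      simpa using (E.tendsto_deltaIter B hsurj hreg ha hθ _ l).mul_const (algebraMap L C (z l))
    simpa [dotProduct] using this
  choose N hN using fun k' => E.exists_coord_eq_zero (y.act φ.sigma (E.h k')) k
  have hterm : ∀ᶠ i in Filter.atTop, ∀ k', ∀ p ∈ Finset.range (N k'),
      ‖algebraMap L C ((E.deltaIter B i (x.act φ.tau (E.g k')) ⬝ᵥ z) *
        (frob Fq L).symm^[i] (E.coord (y.act φ.sigma (E.h k')) k p))‖ < ε / 2 := by
    refine Filter.eventually_all.2 fun k' => (Filter.eventually_all_finset _).2 fun p _ => ?_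
    have := Filter.isBoundedUnder_le_mul_tendsto_zero
      (isBoundedUnder_norm_frob_symm_iterate (Fq := Fq) (C := C)
        (E.coord (y.act φ.sigma (E.h k')) k p)) (hD k')
    filter_upwards [NormedAddGroup.tendsto_nhds_zero.1 this (ε / 2) (half_pos hε)] with i hi
    rwa [mul_comm, map_mul]
  obtain ⟨i₀, hi₀⟩ := Filter.eventually_atTop.1 hterm
  -- Beyond this index, either `i ≥ i₀` and the summand is small, or `j - i` exceeds every degree in
  -- `σ` and it vanishes.
  filter_upwards [Filter.eventually_ge_atTop (i₀ + Finset.univ.sup N)] with j hj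
  refine lt_of_le_of_lt ?_ (half_lt_self hε)
  rw [series, finsum_eq_sum_of_support_subset _ (E.support_coord_term_subset B x y z k j), map_sum]
  refine IsUltrametricDist.norm_sum_le_of_forall_le_of_nonneg (half_pos hε).le fun i hi => ?_
  rw [coord_term, map_sum]
  refine IsUltrametricDist.norm_sum_le_of_forall_le_of_nonneg (half_pos hε).le fun k' _ => ?_
  rw [if_pos (Nat.lt_succ_iff.1 (Finset.mem_range.1 hi))]
  by_cases hp : j - i < N k'
  · have : N k' ≤ Finset.univ.sup N := Finset.le_sup (Finset.mem_univ k')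
    exact (hi₀ i (by omega) k' _ (Finset.mem_range.2 hp)).le
  · rw [hN k' _ (not_lt.1 hp), iterate_map_zero, mul_zero, map_zero, norm_zero]
    exact (half_pos hε).le

theorem memNSigma_series [IsUltrametricDist C] (hsurj : Function.Surjective φ.tauK)
    (hreg : ∀ n m, φ.IsRegularAtXi (B.tauInv^[n] (1 ⊗ₜ m))) {a : A} {θ : L}
    (ha : φ.lie a = Matrix.scalar (Fin d) θ) (hθ : 1 < ‖algebraMap L C θ‖)
    (x : LATau Fq A L) (y : LASigma Fq A L) (z : Fin d → L) :
    MemNSigma Fq C (E.series B x y z) :=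
  tendsto_pi_nhds.2 fun k =>
    (E.tendsto_series B hsurj hreg ha hθ x y z k).pow_pow_zero Fintype.card_pos

theorem isExponential_expCoeff (hsurj : Function.Surjective φ.tauK)
    (hreg : ∀ n m, φ.IsRegularAtXi (B.tauInv^[n] (1 ⊗ₜ m))) :
    φ.IsExponential C fun n => (E.expCoeff B n).map (algebraMap L C) where
  zero := by
    rw [expCoeff_zero]
    exact (algebraMap L C).mapMatrix.map_one
  functional a n := by
    have h := congrArg (algebraMap L C).mapMatrix (E.expCoeff_functional B hsurj hreg a n)
    rw [map_mul, map_sum] at h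
    simpa [Matrix.map_map, Function.comp_def] using h

/-- In a complete ultrametric field it suffices that terms tend to zero; here they are sums of
`q^n`-th powers of null sequences. -/
theorem summable_expCoeff [IsUltrametricDist C] [CompleteSpace C]
    (hsurj : Function.Surjective φ.tauK)
    (hreg : ∀ n m, φ.IsRegularAtXi (B.tauInv^[n] (1 ⊗ₜ m))) {a : A} {θ : L}
    (ha : φ.lie a = Matrix.scalar (Fin d) θ) (hθ : 1 < ‖algebraMap L C θ‖) (z : Fin d → C) :
    Summable fun i => ((E.expCoeff B i).map (algebraMap L C)).mulVec (twistVec Fq i z) := by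
  refine Pi.summable.2 fun k => NonarchimedeanAddGroup.summable_of_tendsto_cofinite_zero ?_
  rw [Nat.cofinite_eq_atTop]
  have : Filter.Tendsto (fun n => ∑ l, (algebraMap L C (E.deltaIter B n (E.g k) l) * z l) ^
      Fintype.card Fq ^ n) Filter.atTop (𝓝 (∑ _l : Fin d, 0)) := by
    refine tendsto_finsetSum _ fun l _ => Filter.Tendsto.pow_pow_zero ?_ Fintype.card_pos
    simpa using (E.tendsto_deltaIter B hsurj hreg ha hθ _ l).mul_const (z l)
  simpa [Matrix.mulVec, dotProduct, expCoeff, twistVec, mul_pow] using this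

theorem pairing_one_one (z : Fin d → L) :
    E.pairing C B 1 1 z = ∑' i, ((E.expCoeff B i).map (algebraMap L C)).mulVec
      (twistVec Fq i fun k => algebraMap L C (z k)) := by
  refine tsum_congr fun j => funext fun k => ?_
  have h : E.series B 1 1 z k j ^ Fintype.card Fq ^ j =
      ∑ l, E.expCoeff B j k l * z l ^ Fintype.card Fq ^ j := by
    rw [series_one_one, ← frobPow_apply]
    simp [dotProduct, frobPow_apply, expCoeff, mul_pow]
  change algebraMap L C (E.series B 1 1 z k j) ^ Fintype.card Fq ^ j = _
  rw [← map_pow, h]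
  simp [Matrix.mulVec, dotProduct, twistVec]

end AdaptedBases

/-! ### Uniqueness of the exponential -/

/-- If two solutions agree below `n`, the equation for an `a` with `d[a] = θ` gives `(θ^{q^n} -
θ)(Q'ₙ - Qₙ) = 0`. -/
theorem IsExponential.unique {Fq A L C : Type*} [Field Fq] [Fintype Fq] [CommRing A] [Algebra Fq A]
    [Field L] [Algebra Fq L] [IsAlgClosed L] [Algebra A L] [NormedField C] [Algebra L C]
    {d : ℕ} {φ : AndersonModule Fq A L d} {a : A} {θ : L}
    (ha : φ.lie a = Matrix.scalar (Fin d) θ) (hθ : ∀ n, 0 < n → θ ^ Fintype.card Fq ^ n ≠ θ)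
    {Q Q' : ℕ → Matrix (Fin d) (Fin d) C} (hQ : φ.IsExponential C Q)
    (hQ' : φ.IsExponential C Q') : Q' = Q := by
  funext n
  induction n using Nat.strong_induction_on with
  | _ n ih =>
    rcases Nat.eq_zero_or_pos n with rfl | hn
    · rw [hQ.zero, hQ'.zero]
    have h := hQ.functional a n
    have h' := hQ'.functional a n
    rw [Finset.Nat.sum_antidiagonal_eq_sum_range_succ_mk, Finset.sum_range_succ'] at h h'
    have hsum : ∑ p ∈ Finset.range n, (φ.coeff a (p + 1)).map (algebraMap L C) *
          (Q' (n - (p + 1))).map (fun x => x ^ Fintype.card Fq ^ (p + 1)) =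
        ∑ p ∈ Finset.range n, (φ.coeff a (p + 1)).map (algebraMap L C) *
          (Q (n - (p + 1))).map (fun x => x ^ Fintype.card Fq ^ (p + 1)) :=
      Finset.sum_congr rfl fun p hp => by rw [ih _ (by omega)]
    simp only [hsum] at h'
    have hq : Fintype.card Fq ^ n ≠ 0 := (pow_pos Fintype.card_pos n).ne'
    have e0 : (φ.coeff a 0).map (algebraMap L C) = algebraMap L C θ • 1 := by
      change (φ.lie a).map _ = _
      rw [ha]
      ext i j
      by_cases hij : i = j <;> simp [hij]
    have e1 : (φ.lie a).map (fun x => algebraMap L C x ^ Fintype.card Fq ^ n) =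
        algebraMap L C θ ^ Fintype.card Fq ^ n • 1 := by
      rw [ha]
      ext i j
      by_cases hij : i = j <;> simp [hij]
    simp only [e0, e1, Matrix.smul_mul, Matrix.mul_smul, Matrix.one_mul, Matrix.mul_one,
      Nat.sub_zero, pow_zero, pow_one, Matrix.map_id'] at h h'
    have h1 : (algebraMap L C θ ^ Fintype.card Fq ^ n - algebraMap L C θ) • (Q' n - Q n) = 0 := by
      rw [sub_smul, smul_sub, smul_sub, h, h']
      abel
    rcases smul_eq_zero.1 h1 with h2 | h2
    · rw [← map_pow, ← map_sub, map_eq_zero, sub_eq_zero] at h2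
      exact absurd h2 (hθ n hn)
    · exact sub_eq_zero.1 h2

end AndersonModule

/-! ### Choice of `a` and assembly -/

theorem FiniteField.sub_pow_card_pow (Fq : Type*) {R : Type*} [Field Fq] [Fintype Fq] [CommRing R]
    [Algebra Fq R] (x y : R) (n : ℕ) : (x - y) ^ Fintype.card Fq ^ n =
      x ^ Fintype.card Fq ^ n - y ^ Fintype.card Fq ^ n := by
  induction n with
  | zero => simp
  | succ n ih =>
    rw [pow_succ, pow_mul, pow_mul, pow_mul, ih]
    exact map_sub (FiniteField.frobeniusAlgHom Fq R) _ _

/-- The power `q^n > n` of the nilpotent `1 ⊗ a - a ⊗ 1` on `M/τM` is again of this shape, for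
`a^{q^n}`. Thus the nilpotent part of `d[a]` is removed. -/
theorem AndersonModule.AdaptedBases.exists_sub_smul_mem_tauRange {Fq A L : Type*} [Field Fq]
    [Fintype Fq] [CommRing A] [Algebra Fq A] [Field L] [Algebra Fq L] [IsAlgClosed L] [Algebra A L]
    {d : ℕ} {φ : AndersonModule Fq A L d} (E : φ.AdaptedBases) (a : A) :
    ∃ n, ∀ m : φ.Motive, ((1 : L) ⊗ₜ[Fq] (a ^ Fintype.card Fq ^ n) -
      algebraMap A L (a ^ Fintype.card Fq ^ n) ⊗ₜ[Fq] (1 : A) : LA Fq A L) • m ∈ φ.tauRange := by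
  obtain ⟨n, hn⟩ := E.exists_sub_pow_smul_mem a
  refine ⟨n, fun m => ?_⟩
  have := hn (Fintype.card Fq ^ n) (Nat.lt_pow_self Fintype.one_lt_card).le m
  rwa [FiniteField.sub_pow_card_pow Fq, Algebra.TensorProduct.tmul_pow,
    Algebra.TensorProduct.tmul_pow, one_pow, one_pow, ← map_pow] at this

theorem AndersonModule.AdaptedBases.pairing_and_exponential {Fq A L C : Type*} [Field Fq]
    [Fintype Fq] [CommRing A] [Algebra Fq A] [Field L] [Algebra Fq L] [IsAlgClosed L] [Algebra A L]
    [IsScalarTower Fq A L] [NormedField C] [CompleteSpace C] [IsUltrametricDist C] [Algebra L C]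
    {d r : ℕ} {φ : AndersonModule Fq A L d} (hφ : φ.IsAbelian r) (B : φ.MotivicBases r)
    (E : φ.AdaptedBases) (hinj : Function.Injective (algebraMap A L)) (b : A)
    (hb : 1 < ‖algebraMap L C (algebraMap A L b)‖) :
    (∀ (x : LATau Fq A L) (y : LASigma Fq A L) (z : Fin d → L),
      (∀ (i : ℕ) (k : Fin d),
        φ.IsRegularAtXi (B.tauInv^[i] (1 ⊗ₜ x.act φ.tau (E.g k)))) ∧
      (∀ (k : Fin d) (j : ℕ),
        (Function.support fun i => E.coord (E.term B x y z i) k j).Finite) ∧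
      AndersonModule.MemNSigma Fq C (E.series B x y z)) ∧
    ∃ Q : ℕ → Matrix (Fin d) (Fin d) C,
      φ.IsExponential C Q ∧
      (∀ Q', φ.IsExponential C Q' → Q' = Q) ∧
      (∀ z : Fin d → C,
        Summable fun i => (Q i).mulVec (AndersonModule.twistVec Fq i z)) ∧
      ∀ z : Fin d → L,
        E.pairing C B 1 1 z =
          ∑' i, (Q i).mulVec (AndersonModule.twistVec Fq i fun k => algebraMap L C (z k)) := by
  have := hφ.projective
  have : Module.Flat (LA Fq A L) φ.Motive := inferInstance
  obtain ⟨n, hn⟩ := E.exists_sub_smul_mem_tauRange b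
  set a : A := b ^ Fintype.card Fq ^ n with ha
  have hnorm : 1 < ‖algebraMap L C (algebraMap A L a)‖ := by
    rw [ha, map_pow, map_pow, norm_pow]
    exact one_lt_pow₀ hb (pow_pos Fintype.card_pos n).ne'
  -- Norm `> 1` forces the powers of `θ` to have strictly larger norm.
  have hne : ∀ i, 0 < i → algebraMap A L a ^ Fintype.card Fq ^ i ≠ algebraMap A L a := by
    intro i hi h
    have h1 := congrArg (fun x => ‖algebraMap L C x‖) h
    simp only [map_pow, norm_pow] at h1
    have h2 := lt_self_pow₀ hnorm (Nat.one_lt_pow hi.ne' (Fintype.one_lt_card (α := Fq)))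
    exact h2.ne' h1
  have hinj' : Function.Injective ((algebraMap L C).comp (algebraMap A L)) :=
    (algebraMap L C).injective.comp hinj
  have hsurj := AndersonModule.tauK_surjective
    (one_tmul_sub_tmul_one_mem_nonZeroDivisors _ hinj' a hnorm (algebraMap A L a)) hn
  have hreg := B.isRegularAtXi_tauInv_iterate hsurj hne hn
  have hlie := E.lie_eq_scalar_of_smul_mem a _ hn
  have hexp := E.isExponential_expCoeff (C := C) B hsurj hreg
  refine ⟨fun x y z => ⟨fun i k => hreg i _, fun k j => ?_, ?_⟩, _, hexp, fun Q' hQ' => ?_,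
    fun z => ?_, fun z => ?_⟩
  · exact (Finset.finite_toSet _).subset (E.support_coord_term_subset B x y z k j)
  · exact E.memNSigma_series B hsurj hreg hlie hnorm x y z
  · exact hexp.unique hlie hne hQ'
  · exact E.summable_expCoeff B hsurj hreg hlie hnorm z
  · exact E.pairing_one_one B z

end

theorem theorem3
    {Fq K C : Type*} [Field Fq] [Fintype Fq] [Field K] [Algebra Fq K]
    [NormedField C] [Algebra K C] [Algebra Fq C] [IsScalarTower Fq K C]
    (A : Subalgebra Fq K) (V : ValuationSubring K) (hA : IsCurveMinusPoint A V)
    (hC : IsCompletedAlgClosure V C)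
    (L : IntermediateField K C) [IsAlgClosed L]
    {d r : ℕ} (φ : AndersonModule Fq A L d) (hφ : φ.IsAbelian r)
    (B : φ.MotivicBases r) (hB : B.IsXiRegular) (E : φ.AdaptedBases) :
    (∀ (x : LATau Fq A L) (y : LASigma Fq A L) (z : Fin d → L),
      (∀ (i : ℕ) (k : Fin d),
        φ.IsRegularAtXi (B.tauInv^[i] (1 ⊗ₜ x.act φ.tau (E.g k)))) ∧
      (∀ (k : Fin d) (j : ℕ),
        (Function.support fun i => E.coord (E.term B x y z i) k j).Finite) ∧
      AndersonModule.MemNSigma Fq C (E.series B x y z)) ∧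
    ∃ Q : ℕ → Matrix (Fin d) (Fin d) C,
      φ.IsExponential C Q ∧
      (∀ Q', φ.IsExponential C Q' → Q' = Q) ∧
      (∀ z : Fin d → C,
        Summable fun i => (Q i).mulVec (AndersonModule.twistVec Fq i z)) ∧
      ∀ z : Fin d → L,
        E.pairing C B 1 1 z =
          ∑' i, (Q i).mulVec (AndersonModule.twistVec Fq i fun k => (z k : C)) := by
  have := hC.completeSpace
  have := hC.isUltrametricDist
  have : IsScalarTower Fq A L := IsScalarTower.of_algebraMap_eq fun x =>
    Subtype.ext (IsScalarTower.algebraMap_apply Fq K C x)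
  -- The place `V` is not centred on `Spec A`, so some function in `A` has a pole at `∞`, that is,
  -- norm `> 1`.
  obtain ⟨b, hbA, hbV⟩ := Set.not_subset.1 ((hA.not_le_iff V hA.ne_top).2 rfl)
  have hb : 1 < ‖algebraMap K C b‖ := not_le.1 fun h => hbV ((hC.norm_le_one_iff b).1 h)
  exact AndersonModule.AdaptedBases.pairing_and_exponential hφ B E
    ((algebraMap K L).injective.comp Subtype.val_injective) ⟨b, hbA⟩ hb
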